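/- Let $\Bbbk$ be an algebraically closed field, write $D=\operatorname{Hom}_{\Bbbk}(-,\Bbbk)$, and let $\mathcal E$ be a $\Bbbk$-linear additive category. A *Frobenius exact structure* on $\mathcal E$ is a (Quillen) exact structure with enough projective and enough injective objects whose projective and injective objects coincide; we write $\mathcal E_{\mathcal P}$ for such a structure with class of projective objects $\mathcal P$. Its *stable category* $\underline{\mathcal E}_{\mathcal P}$ is the additive quotient $\mathcal E/\mathcal P$ with Happel's triangulated structure, whose suspension is the cosyzygy functor. Triangulated subcategories are full and closed under isomorphism. A triangulated category $\mathcal T$ is the direct sum $\mathcal C_1\oplus\mathcal C_2$ of triangulated subcategories if there are no non-zero morphisms between $\mathcal C_1$ and $\mathcal C_2$ in either direction and each object of $\mathcal T$ is isomorphic to $X_1\oplus X_2$ with $X_i\in\mathcal C_i$. A *Serre functor* on a $\Bbbk$-linear category is a $\Bbbk$-linear autoequivalence $\mathbb S$ together with $\Bbbk$-linear isomorphisms $\operatorname{Hom}(X,Y)\cong D\operatorname{Hom}(Y,\mathbb S X)$ natural in $X$ and $Y$. **Lemma.** Let $\mathcal E_{\mathcal P}$ be a Frobenius exact structure on $\mathcal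 E$ such that $\underline{\mathcal E}_{\mathcal P}=\mathcal C_1\oplus\mathcal C_2$ is a direct sum of triangulated subcategories, and assume that $\underline{\mathcal E}_{\mathcal P}$ has a Serre functor $\mathbb S$. Then $\mathbb S$ restricts to a Serre functor on $\mathcal C_1$ and to a Serre functor on $\mathcal C_2$, and there is a Frobenius exact structure $\mathcal E_{\mathcal M}$ on the same category $\mathcal E$ such that there is a ($\Bbbk$-linear) triangle equivalence $\underline{\mathcal E}_{\mathcal M}\cong\mathcal C_1$. -/

import Mathlib

open CategoryTheory CategoryTheory.Limits

universe w v u v' u'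

set_option linter.unusedSectionVars false

namespace ExactCat

/-! ### Exact structures -/

section Exact

variable {E : Type u} [Category.{v} E] [Preadditive E]

/-- `i` is the first map of a member of the class `c` of short complexes. -/
def IsInflationOf (c : ObjectProperty (ShortComplex E)) {A B : E} (i : A ⟶ B) : Prop :=
  ∃ (Z : E) (p : B ⟶ Z) (h : i ≫ p = 0), c (ShortComplex.mk i p h)

/-- `p` is the second map of a member of the class `c` of short complexes. -/
def IsDeflationOf (c : ObjectProperty (ShortComplex E)) {B Z : E} (p : B ⟶ Z) : Prop :=
  ∃ (A : E) (i : A ⟶ B) (h : i ≫ p = 0), c (ShortComplex.mk i p h)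

variable (E) in
/-- An exact structure (in the sense of Quillen; the axioms are those in Bühler's survey) on an
additive category `E`: a class of kernel-cokernel pairs, closed under isomorphism, such that
identities are inflations and deflations, inflations and deflations are closed under composition,
inflations have pushouts along arbitrary morphisms and these are inflations, and deflations have
pullbacks along arbitrary morphisms and these are deflations. -/
structure ExactStructure where
  /-- the conflations `A ↣ B ↠ Z` -/
  conflation : ObjectProperty (ShortComplex E)
  conflation_of_iso : ∀ {S T : ShortComplex E}, (S ≅ T) → conflation S → conflation T
  isKernel : ∀ S : ShortComplex E, conflation S → Nonempty (IsLimit (KernelFork.ofι S.f S.zero))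
  isCokernel : ∀ S : ShortComplex E, conflation S →
    Nonempty (IsColimit (CokernelCofork.ofπ S.g S.zero))
  inflation_id : ∀ A : E, IsInflationOf conflation (𝟙 A)
  deflation_id : ∀ A : E, IsDeflationOf conflation (𝟙 A)
  inflation_comp : ∀ {A B C : E} (i : A ⟶ B) (j : B ⟶ C),
    IsInflationOf conflation i → IsInflationOf conflation j → IsInflationOf conflation (i ≫ j)
  deflation_comp : ∀ {A B C : E} (p : A ⟶ B) (q : B ⟶ C),
    IsDeflationOf conflation p → IsDeflationOf conflation q → IsDeflationOf conflation (p ≫ q)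
  inflation_pushout : ∀ {A B A' : E} (i : A ⟶ B) (f : A ⟶ A'), IsInflationOf conflation i →
    ∃ (B' : E) (f' : B ⟶ B') (i' : A' ⟶ B'), IsPushout i f f' i' ∧ IsInflationOf conflation i'
  deflation_pullback : ∀ {B Z Z' : E} (p : B ⟶ Z) (f : Z' ⟶ Z), IsDeflationOf conflation p →
    ∃ (B' : E) (f' : B' ⟶ B) (p' : B' ⟶ Z'), IsPullback f' p' p f ∧ IsDeflationOf conflation p'

namespace ExactStructure

variable (S : ExactStructure E)

/-- Admissible monomorphisms. -/
def IsInflation {A B : E} (i : A ⟶ B) : Prop := IsInflationOf S.conflation i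

/-- Admissible epimorphisms. -/
def IsDeflation {B Z : E} (p : B ⟶ Z) : Prop := IsDeflationOf S.conflation p

/-- The projective objects of an exact category. -/
def projectives : ObjectProperty E := fun P =>
  ∀ ⦃B Z : E⦄ (p : B ⟶ Z), S.IsDeflation p → ∀ f : P ⟶ Z, ∃ g : P ⟶ B, g ≫ p = f

/-- The injective objects of an exact category. -/
def injectives : ObjectProperty E := fun I =>
  ∀ ⦃A B : E⦄ (i : A ⟶ B), S.IsInflation i → ∀ f : A ⟶ I, ∃ g : B ⟶ I, i ≫ g = f

/-- Two parallel morphisms are identified in the additive quotient of `E` by the projective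
objects if their difference factors through a projective object. -/
def stableRel : HomRel E := fun X Y f g =>
  ∃ (P : E) (_ : S.projectives P) (a : X ⟶ P) (b : P ⟶ Y), f - g = a ≫ b

end ExactStructure

end Exact

section StableHom

variable {E : Type u} [Category.{v} E] [Preadditive E] [HasZeroObject E] [HasBinaryBiproducts E]

namespace ExactStructure

variable (S : ExactStructure E)

theorem projectives_biprod {P Q : E} (hP : S.projectives P) (hQ : S.projectives Q) :
    S.projectives (P ⊞ Q) := by
  intro B Z p hp f
  obtain ⟨g, hg⟩ := hP p hp (biprod.inl ≫ f)
  obtain ⟨g', hg'⟩ := hQ p hp (biprod.inr ≫ f)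
  refine ⟨biprod.desc g g', ?_⟩
  ext <;> simp [hg, hg']

theorem stableRel_add {X Y : E} (f₁ f₂ g₁ g₂ : X ⟶ Y) (hf : S.stableRel f₁ f₂)
    (hg : S.stableRel g₁ g₂) : S.stableRel (f₁ + g₁) (f₂ + g₂) := by
  obtain ⟨P, hP, a, b, h⟩ := hf
  obtain ⟨Q, hQ, c, d, h'⟩ := hg
  refine ⟨P ⊞ Q, S.projectives_biprod hP hQ, biprod.lift a c, biprod.desc b d, ?_⟩
  rw [biprod.lift_desc, ← h, ← h']
  abel

theorem stableRel_refl {X Y : E} (f : X ⟶ Y) : S.stableRel f f :=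
  ⟨(HasZeroObject.zero' E).zero, fun _ _ _ _ f => ⟨0, (isZero_zero E).eq_of_src _ _⟩, 0, 0, by simp⟩

theorem stableRel_symm {X Y : E} {f g : X ⟶ Y} (h : S.stableRel f g) : S.stableRel g f := by
  obtain ⟨P, hP, a, b, h⟩ := h
  exact ⟨P, hP, -a, b, by rw [Preadditive.neg_comp, ← h, neg_sub]⟩

instance stableRel_congruence : Congruence S.stableRel where
  equivalence :=
    { refl := S.stableRel_refl
      symm := S.stableRel_symm
      trans := by
        rintro f g h ⟨P, hP, a, b, h₁⟩ ⟨Q, hQ, c, d, h₂⟩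
        refine ⟨P ⊞ Q, S.projectives_biprod hP hQ, biprod.lift a c, biprod.desc b d, ?_⟩
        rw [biprod.lift_desc, ← h₁, ← h₂]
        abel }
  comp_left := by
    rintro X Y Z f g g' ⟨P, hP, a, b, h⟩
    exact ⟨P, hP, f ≫ a, b, by rw [← Preadditive.comp_sub, h, Category.assoc]⟩
  comp_right := by
    rintro X Y Z f f' g ⟨P, hP, a, b, h⟩
    exact ⟨P, hP, a, b ≫ g, by rw [← Preadditive.sub_comp, h, Category.assoc]⟩

/-- The additive quotient of `E` by the projective objects. -/
abbrev Stable : Type u := CategoryTheory.Quotient S.stableRel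

instance : Preadditive S.Stable :=
  CategoryTheory.Quotient.preadditive _ (fun _ _ => S.stableRel_add)

instance : (CategoryTheory.Quotient.functor S.stableRel).Additive :=
  CategoryTheory.Quotient.functor_additive _ (fun _ _ => S.stableRel_add)

instance (k : Type w) [Semiring k] [Linear k E] : Linear k S.Stable :=
  CategoryTheory.Quotient.linear k _ (by
    rintro c X Y f g ⟨P, hP, a, b, h⟩
    exact ⟨P, hP, c • a, b, by rw [← smul_sub, h, Linear.smul_comp]⟩)

end ExactStructure

/-! ### Frobenius exact structures and their stable categories -/

variable (E) in
/-- A Frobenius exact structure: an exact structure with enough projective and enough injective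
objects whose projective and injective objects coincide. -/
structure FrobeniusStructure extends ExactStructure E where
  enough_projectives : ∀ X : E, ∃ (P : E) (p : P ⟶ X),
    toExactStructure.projectives P ∧ toExactStructure.IsDeflation p
  enough_injectives : ∀ X : E, ∃ (I : E) (i : X ⟶ I),
    toExactStructure.injectives I ∧ toExactStructure.IsInflation i
  projective_iff_injective : ∀ X : E,
    toExactStructure.projectives X ↔ toExactStructure.injectives X

namespace FrobeniusStructure

variable (F : FrobeniusStructure E)

/-- The underlying category of the stable category: the additive quotient of `E` by the
projective-injective objects. -/
abbrev Stable : Type u := F.toExactStructure.Stable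

/-- The quotient functor from `E` to the stable category. -/
abbrev toStable : E ⥤ F.Stable := CategoryTheory.Quotient.functor F.stableRel

/-- A chosen injective object receiving an inflation from `X`. -/
noncomputable def hull (X : E) : E := (F.enough_injectives X).choose

/-- The chosen inflation of `X` into an injective object. -/
noncomputable def hullMap (X : E) : X ⟶ F.hull X := (F.enough_injectives X).choose_spec.choose

theorem hull_injective (X : E) : F.injectives (F.hull X) :=
  (F.enough_injectives X).choose_spec.choose_spec.1

theorem hullMap_inflation (X : E) : F.IsInflation (F.hullMap X) :=
  (F.enough_injectives X).choose_spec.choose_spec.2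

/-- The cosyzygy of `X`, defined by the conflation `X ↣ hull X ↠ cosyzygy X`. -/
noncomputable def cosyzygy (X : E) : E := (F.hullMap_inflation X).choose

/-- The deflation in the conflation `X ↣ hull X ↠ cosyzygy X`. -/
noncomputable def cosyzygyMap (X : E) : F.hull X ⟶ F.cosyzygy X :=
  (F.hullMap_inflation X).choose_spec.choose

theorem hullMap_cosyzygyMap (X : E) : F.hullMap X ≫ F.cosyzygyMap X = 0 :=
  (F.hullMap_inflation X).choose_spec.choose_spec.choose

theorem hull_conflation (X : E) :
    F.conflation (ShortComplex.mk (F.hullMap X) (F.cosyzygyMap X) (F.hullMap_cosyzygyMap X)) :=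
  (F.hullMap_inflation X).choose_spec.choose_spec.choose_spec

theorem cosyzygy_desc {X Z : E} (e : F.hull X ⟶ Z) (he : F.hullMap X ≫ e = 0) :
    ∃ s : F.cosyzygy X ⟶ Z, F.cosyzygyMap X ≫ s = e := by
  obtain ⟨hc⟩ := F.isCokernel _ (F.hull_conflation X)
  exact ⟨hc.desc (CokernelCofork.ofπ e he), hc.fac (CokernelCofork.ofπ e he) .one⟩

theorem cosyzygy_hom_ext {X Z : E} {s t : F.cosyzygy X ⟶ Z}
    (h : F.cosyzygyMap X ≫ s = F.cosyzygyMap X ≫ t) : s = t := by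
  obtain ⟨hc⟩ := F.isCokernel _ (F.hull_conflation X)
  exact Cofork.IsColimit.hom_ext hc h

/-- `s` is a morphism induced on cosyzygies by `f`, through an extension `e` of `f` to the
chosen injective objects. -/
def IsCosyzygyLift {X Y : E} (f : X ⟶ Y) (s : F.cosyzygy X ⟶ F.cosyzygy Y) : Prop :=
  ∃ e : F.hull X ⟶ F.hull Y, F.hullMap X ≫ e = f ≫ F.hullMap Y ∧
    F.cosyzygyMap X ≫ s = e ≫ F.cosyzygyMap Y

theorem exists_cosyzygyLift {X Y : E} (f : X ⟶ Y) :
    ∃ s : F.cosyzygy X ⟶ F.cosyzygy Y, F.IsCosyzygyLift f s := by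
  obtain ⟨e, he⟩ := F.hull_injective Y (F.hullMap X) (F.hullMap_inflation X) (f ≫ F.hullMap Y)
  obtain ⟨s, hs⟩ := F.cosyzygy_desc (e ≫ F.cosyzygyMap Y) (by
    rw [← Category.assoc, he, Category.assoc, hullMap_cosyzygyMap, comp_zero])
  exact ⟨s, e, he, hs⟩

theorem cosyzygyLift_unique {X Y : E} {f g : X ⟶ Y} {s t : F.cosyzygy X ⟶ F.cosyzygy Y}
    (hfg : F.stableRel f g) (hs : F.IsCosyzygyLift f s) (ht : F.IsCosyzygyLift g t) :
    F.toStable.map s = F.toStable.map t := by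
  obtain ⟨P, hP, a, b, hab⟩ := hfg
  obtain ⟨e, he, hs⟩ := hs
  obtain ⟨e', he', ht⟩ := ht
  obtain ⟨a', ha'⟩ := (F.projective_iff_injective P).1 hP (F.hullMap X) (F.hullMap_inflation X) a
  obtain ⟨r, hr⟩ := F.cosyzygy_desc (e - e' - a' ≫ b ≫ F.hullMap Y) (by
    rw [Preadditive.comp_sub, Preadditive.comp_sub, he, he', ← Category.assoc _ a', ha',
      ← Preadditive.sub_comp, hab, Category.assoc, sub_self])
  refine CategoryTheory.Quotient.sound _ ⟨F.hull Y,
    (F.projective_iff_injective _).2 (F.hull_injective Y), r, F.cosyzygyMap Y, ?_⟩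
  apply F.cosyzygy_hom_ext
  rw [Preadditive.comp_sub, hs, ht, ← Category.assoc _ r, hr]
  simp [Preadditive.sub_comp, F.hullMap_cosyzygyMap]

/-- The cosyzygy functor on `E`, with values in the stable category. -/
noncomputable def cosyzygyFunctor : E ⥤ F.Stable where
  obj X := F.toStable.obj (F.cosyzygy X)
  map f := F.toStable.map (F.exists_cosyzygyLift f).choose
  map_id X := by
    rw [← F.toStable.map_id]
    exact F.cosyzygyLift_unique (F.stableRel_refl _) (F.exists_cosyzygyLift (𝟙 X)).choose_spec
      ⟨𝟙 _, by simp, by simp⟩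
  map_comp f g := by
    rw [← F.toStable.map_comp]
    refine F.cosyzygyLift_unique (F.stableRel_refl _)
      (F.exists_cosyzygyLift (f ≫ g)).choose_spec ?_
    obtain ⟨e, he, hs⟩ := (F.exists_cosyzygyLift f).choose_spec
    obtain ⟨e', he', hs'⟩ := (F.exists_cosyzygyLift g).choose_spec
    refine ⟨e ≫ e', ?_, ?_⟩
    · rw [← Category.assoc, he, Category.assoc, he', Category.assoc]
    · rw [← Category.assoc, hs, Category.assoc, hs', Category.assoc]

/-- The suspension functor of the stable category, i.e. the cosyzygy functor. -/
noncomputable def suspension : F.Stable ⥤ F.Stable :=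
  CategoryTheory.Quotient.lift _ F.cosyzygyFunctor (fun _ _ f g h =>
    F.cosyzygyLift_unique h (F.exists_cosyzygyLift f).choose_spec
      (F.exists_cosyzygyLift g).choose_spec)

/-- Happel's standard triangles `X ⟶ Y ⟶ C ⟶ cosyzygy X`: the object `C` is the pushout of
`u : X ⟶ Y` and the inflation `X ↣ hull X`, and `w` is the map out of the pushout that vanishes
on `Y` and is the deflation `hull X ↠ cosyzygy X` on `hull X`. -/
def IsStandardTriangle {X Y C : E} (u : X ⟶ Y) (j : Y ⟶ C) (w : C ⟶ F.cosyzygy X) : Prop :=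
  ∃ l : F.hull X ⟶ C, IsPushout (F.hullMap X) u l j ∧ l ≫ w = F.cosyzygyMap X ∧ j ≫ w = 0

/-- The distinguished triangles of the stable category: the triangles that are isomorphic to
(the image of) a standard triangle. -/
def IsDistinguished {X Y Z : F.Stable} (f : X ⟶ Y) (g : Y ⟶ Z) (h : Z ⟶ F.suspension.obj X) :
    Prop :=
  ∃ (A B C : E) (u : A ⟶ B) (j : B ⟶ C) (w : C ⟶ F.cosyzygy A)
    (α : X ≅ F.toStable.obj A) (β : Y ≅ F.toStable.obj B) (γ : Z ≅ F.toStable.obj C),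
    F.IsStandardTriangle u j w ∧
    f ≫ β.hom = α.hom ≫ F.toStable.map u ∧
    g ≫ γ.hom = β.hom ≫ F.toStable.map j ∧
    h ≫ F.suspension.map α.hom = γ.hom ≫ F.toStable.map w

end FrobeniusStructure

end StableHom

/-! ### Triangulated subcategories, direct sums, triangle equivalences -/

/-- The pair `(Σ, Δ)` of a suspension functor and a class of triangles `X ⟶ Y ⟶ Z ⟶ Σ X`
underlying a triangulated category. It only serves to speak in the same way about the stable
category of a Frobenius exact category and about its triangulated subcategories. -/
structure Triangulation (C : Type u) [Category.{v} C] where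
  /-- the suspension functor -/
  shift : C ⥤ C
  /-- the distinguished triangles -/
  dist : ∀ {X Y Z : C}, (X ⟶ Y) → (Y ⟶ Z) → (Z ⟶ shift.obj X) → Prop

/-- Happel's triangulated structure on the stable category of a Frobenius exact category. -/
noncomputable def FrobeniusStructure.triangulation {E : Type u} [Category.{v} E] [Preadditive E]
    [HasZeroObject E] [HasBinaryBiproducts E] (F : FrobeniusStructure E) :
    Triangulation F.Stable where
  shift := F.suspension
  dist := F.IsDistinguished

namespace Triangulation

variable {C : Type u} [Category.{v} C] (T : Triangulation C)

/-- A triangulated subcategory, identified with its class of objects: a full subcategory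
containing a zero object, closed under isomorphism, under the suspension and its inverse, and
under cones. -/
structure IsTriangulatedSubcategory [HasZeroMorphisms C] (P : ObjectProperty C) : Prop where
  containsZero : P.ContainsZero
  isoClosed : P.IsClosedUnderIsomorphisms
  shift_iff : ∀ X : C, P (T.shift.obj X) ↔ P X
  cone : ∀ ⦃X Y Z : C⦄ (f : X ⟶ Y) (g : Y ⟶ Z) (h : Z ⟶ T.shift.obj X),
    T.dist f g h → P X → P Y → P Z

/-- The ambient category is the direct sum of the triangulated subcategories `P₁` and `P₂`: there
are no nonzero morphisms between them, and every object is a direct sum of an object of `P₁` and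
an object of `P₂`. -/
structure IsDirectSum [HasZeroMorphisms C] (P₁ P₂ : ObjectProperty C) : Prop where
  left : T.IsTriangulatedSubcategory P₁
  right : T.IsTriangulatedSubcategory P₂
  hom_left_right : ∀ ⦃X Y : C⦄, P₁ X → P₂ Y → ∀ f : X ⟶ Y, f = 0
  hom_right_left : ∀ ⦃X Y : C⦄, P₂ X → P₁ Y → ∀ f : X ⟶ Y, f = 0
  decomposition : ∀ X : C, ∃ (X₁ X₂ : C) (b : BinaryBicone X₁ X₂),
    P₁ X₁ ∧ P₂ X₂ ∧ Nonempty b.IsBilimit ∧ Nonempty (X ≅ b.pt)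

/-- The triangulated structure of a full subcategory closed under the suspension: the suspension
and the distinguished triangles are those of the ambient category. -/
def restrict (P : ObjectProperty C) (hP : ∀ X : C, P X → P (T.shift.obj X)) :
    Triangulation P.FullSubcategory where
  shift := P.lift (P.ι ⋙ T.shift) (fun X => hP _ X.property)
  dist f g h := T.dist (P.ι.map f) (P.ι.map g) (P.ι.map h)

/-- A `k`-linear triangle equivalence: a `k`-linear equivalence that commutes with the suspension
up to a natural isomorphism and, with respect to it, maps distinguished triangles to
distinguished triangles. -/
structure TriangleEquivalence (k : Type w) [Semiring k] {C : Type u} [Category.{v} C]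
    [Preadditive C] [Linear k C] (T : Triangulation C) {D : Type u'} [Category.{v'} D]
    [Preadditive D] [Linear k D] (U : Triangulation D) where
  /-- the underlying functor -/
  functor : C ⥤ D
  isEquivalence : functor.IsEquivalence
  additive : functor.Additive
  linear : functor.Linear k
  /-- the compatibility with the suspension functors -/
  commShift : T.shift ⋙ functor ≅ functor ⋙ U.shift
  map_dist : ∀ {X Y Z : C} (f : X ⟶ Y) (g : Y ⟶ Z) (h : Z ⟶ T.shift.obj X), T.dist f g h →
    U.dist (functor.map f) (functor.map g) (functor.map h ≫ commShift.hom.app X)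

end Triangulation

/-! ### Serre functors -/

section Serre

variable (k : Type w) [Field k] {C : Type u} [Category.{v} C] [Preadditive C] [Linear k C]

/-- `k`-linear isomorphisms `Hom(X, Y) ≅ D Hom(Y, S X)`, with `D = Hom_k(-, k)`, natural in `X`
and in `Y`. -/
structure SerreDuality (S : C ⥤ C) where
  /-- the duality isomorphisms -/
  iso : ∀ X Y : C, (X ⟶ Y) ≃ₗ[k] Module.Dual k (Y ⟶ S.obj X)
  natural_left : ∀ {X' X Y : C} (a : X' ⟶ X) (f : X ⟶ Y) (t : Y ⟶ S.obj X'),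
    iso X' Y (a ≫ f) t = iso X Y f (t ≫ S.map a)
  natural_right : ∀ {X Y Y' : C} (f : X ⟶ Y) (b : Y ⟶ Y') (t : Y' ⟶ S.obj X),
    iso X Y' (f ≫ b) t = iso X Y f (b ≫ t)

/-- `S` is a Serre functor: a `k`-linear autoequivalence with a Serre duality. (The existence of
such isomorphisms for an equivalence `S` forces all Hom spaces to be finite dimensional.) -/
structure IsSerreFunctor (S : C ⥤ C) : Prop where
  isEquivalence : S.IsEquivalence
  additive : S.Additive
  linear : S.Linear k
  duality : Nonempty (SerreDuality k S)

end Serre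

end ExactCat

/-! A conflation `A ↣ B ↠ Z` of the given structure has a connecting class `ω : Z ⟶ ΣA` in the
stable category. A morphism `f : M ⟶ Z` lifts to `B` exactly when `f ≫ ω = 0`, and a morphism `f : A
⟶ M` extends to `B` exactly when `ω ≫ Σf = 0`. Because the two summands are orthogonal and stable
under `Σ`, the class `ω` is diagonal for the decomposition. So lifting from all `M` in `C₂` and
extension to all `M` in `C₂` both say that the `C₂`-component of `ω` vanishes
(`forall_lift_iff_forall_extension`).

The new structure keeps the conflations with this property. Deflations are characterised by lifting
and inflations by extension, and each condition is visibly stable under composition and base or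
cobase change. Adding the `C₂`-component of `X` to a projective cover or an injective hull of `X`
gives enough projectives and injectives; up to retracts these are all of them, so both classes
consist of the objects whose stable class lies in `C₂`. Factoring these out of the stable category
leaves `C₁`, and the equivalence is projection to the `C₁`-component.

For the triangulated structure, let `T` lie in `C₁`. A relative hull lies in `C₂`, so `Hom(T, -)`
does not see it or its suspension, which identifies the relative cosyzygy with the suspension of the
component (`bijective_comp_connecting`). A five-lemma argument with `Hom(T, -)` then compares a
relative cone with the cone of the induced morphism on components
(`bijective_comp_hom_component_cone`), and Yoneda inside `C₁` turns these bijections into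
isomorphisms.

The statement on Serre functors is orthogonality: for `X` in `C₁` and `Y` in `C₂`, the space `Hom(Y,
SX)` has dual `Hom(X, Y) = 0`, so `SX` has no `C₂`-component. -/

namespace ExactCat

/-! ### Elementary consequences of the axioms of an exact structure -/

namespace ExactStructure

section

variable {E : Type u} [Category.{v} E] [Preadditive E] (S : ExactStructure E)

variable {S} in
theorem conflation_congr {A B Z A' B' Z' : E} {i : A ⟶ B} {p : B ⟶ Z} {h : i ≫ p = 0}
    {i' : A' ⟶ B'} {p' : B' ⟶ Z'} (hS : S.conflation (ShortComplex.mk i p h)) (h' : i' ≫ p' = 0)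
    (a : A ≅ A') (b : B ≅ B') (c : Z ≅ Z') (hi : a.hom ≫ i' = i ≫ b.hom)
    (hp : b.hom ≫ p' = p ≫ c.hom) : S.conflation (ShortComplex.mk i' p' h') :=
  S.conflation_of_iso (ShortComplex.isoMk a b c hi hp) hS

section Conflation

variable {S} {A B Z : E} {i : A ⟶ B} {p : B ⟶ Z} {h : i ≫ p = 0}

theorem exists_lift_of_conflation (hS : S.conflation (ShortComplex.mk i p h)) {T : E} (k : T ⟶ B)
    (hk : k ≫ p = 0) : ∃ t : T ⟶ A, t ≫ i = k := by
  obtain ⟨hc⟩ := S.isKernel _ hS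
  exact ⟨hc.lift (KernelFork.ofι k hk), hc.fac (KernelFork.ofι k hk) .zero⟩

theorem exists_desc_of_conflation (hS : S.conflation (ShortComplex.mk i p h)) {T : E} (k : B ⟶ T)
    (hk : i ≫ k = 0) : ∃ t : Z ⟶ T, p ≫ t = k := by
  obtain ⟨hc⟩ := S.isCokernel _ hS
  exact ⟨hc.desc (CokernelCofork.ofπ k hk), hc.fac (CokernelCofork.ofπ k hk) .one⟩

theorem mono_of_conflation (hS : S.conflation (ShortComplex.mk i p h)) : Mono i := by
  obtain ⟨hc⟩ := S.isKernel _ hS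
  exact ⟨fun _ _ e => Fork.IsLimit.hom_ext hc e⟩

theorem epi_of_conflation (hS : S.conflation (ShortComplex.mk i p h)) : Epi p := by
  obtain ⟨hc⟩ := S.isCokernel _ hS
  exact ⟨fun _ _ e => Cofork.IsColimit.hom_ext hc e⟩

theorem exists_section_of_retraction (hS : S.conflation (ShortComplex.mk i p h)) {t : B ⟶ A}
    (ht : i ≫ t = 𝟙 A) : ∃ s : Z ⟶ B, s ≫ p = 𝟙 Z := by
  obtain ⟨s, hs⟩ := exists_desc_of_conflation hS (𝟙 B - t ≫ i) (by
    rw [Preadditive.comp_sub, Category.comp_id, ← Category.assoc, ht, Category.id_comp, sub_self])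
  have := epi_of_conflation hS
  refine ⟨s, (cancel_epi p).1 ?_⟩
  rw [← Category.assoc, hs, Preadditive.sub_comp, Category.assoc, h]
  simp

/-- Cokernels are unique up to isomorphism and conflations are closed under isomorphism, so any
cokernel of an inflation completes it to a conflation. -/
theorem conflation_of_isInflation (hi : S.IsInflation i) (h : i ≫ p = 0) [Epi p]
    (hp : ∀ {T : E} (k : B ⟶ T), i ≫ k = 0 → ∃ t : Z ⟶ T, p ≫ t = k) :
    S.conflation (ShortComplex.mk i p h) := by
  obtain ⟨Z', p', h', hS⟩ := hi
  have := epi_of_conflation hS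
  obtain ⟨t, ht⟩ := hp p' h'
  obtain ⟨t', ht'⟩ := exists_desc_of_conflation hS p h
  refine conflation_congr hS h (Iso.refl _) (Iso.refl _)
    ⟨t', t, (cancel_epi p').1 ?_, (cancel_epi p).1 ?_⟩ (by simp) (by simp [ht'])
  · rw [← Category.assoc, ht', ht, Category.comp_id]
  · rw [← Category.assoc, ht, ht', Category.comp_id]

theorem conflation_of_isDeflation (hp : S.IsDeflation p) (h : i ≫ p = 0) [Mono i]
    (hi : ∀ {T : E} (k : T ⟶ B), k ≫ p = 0 → ∃ t : T ⟶ A, t ≫ i = k) :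
    S.conflation (ShortComplex.mk i p h) := by
  obtain ⟨A', i', h', hS⟩ := hp
  have := mono_of_conflation hS
  obtain ⟨t, ht⟩ := hi i' h'
  obtain ⟨t', ht'⟩ := exists_lift_of_conflation hS i h
  refine conflation_congr hS h
    ⟨t, t', (cancel_mono i').1 ?_, (cancel_mono i).1 ?_⟩ (Iso.refl _) (Iso.refl _)
    (by simp [ht]) (by simp)
  · rw [Category.assoc, ht', ht, Category.id_comp]
  · rw [Category.assoc, ht, ht', Category.id_comp]

end Conflation

theorem isInflation_comp_iso {A B B' : E} (i : A ⟶ B) (e : B ≅ B') (hi : S.IsInflation i) :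
    S.IsInflation (i ≫ e.hom) := by
  obtain ⟨Z, p, h, hS⟩ := hi
  exact ⟨Z, e.inv ≫ p, by simp [h],
    conflation_congr hS _ (Iso.refl _) e (Iso.refl _) (by simp) (by simp)⟩

theorem isDeflation_iso_comp {B B' Z : E} (e : B' ≅ B) (p : B ⟶ Z) (hp : S.IsDeflation p) :
    S.IsDeflation (e.hom ≫ p) := by
  obtain ⟨A, i, h, hS⟩ := hp
  exact ⟨A, i ≫ e.inv, by simp [h],
    conflation_congr hS _ (Iso.refl _) e.symm (Iso.refl _) (by simp) (by simp)⟩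

theorem isInflation_of_isPushout {A B A' B' : E} {i : A ⟶ B} {f : A ⟶ A'} {f' : B ⟶ B'}
    {i' : A' ⟶ B'} (sq : IsPushout i f f' i') (hi : S.IsInflation i) : S.IsInflation i' := by
  obtain ⟨B₀, f₀, i₀, sq₀, hi₀⟩ := S.inflation_pushout i f hi
  rw [← sq₀.inr_isoIsPushout_hom _ _ sq]
  exact S.isInflation_comp_iso _ _ hi₀

theorem isDeflation_of_isPullback {B Z B' Z' : E} {p : B ⟶ Z} {f : Z' ⟶ Z} {f' : B' ⟶ B}
    {p' : B' ⟶ Z'} (sq : IsPullback f' p' p f) (hp : S.IsDeflation p) : S.IsDeflation p' := by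
  obtain ⟨B₀, f₀, p₀, sq₀, hp₀⟩ := S.deflation_pullback p f hp
  rw [← sq.isoIsPullback_hom_snd _ _ sq₀]
  exact S.isDeflation_iso_comp _ _ hp₀

variable {S} in
/-- The pushout of a conflation. -/
theorem conflation_of_isPushout {A B Z A' B' : E} {i : A ⟶ B} {p : B ⟶ Z} {h : i ≫ p = 0}
    {f : A ⟶ A'} {f' : B ⟶ B'} {i' : A' ⟶ B'} (hS : S.conflation (ShortComplex.mk i p h))
    (sq : IsPushout i f f' i') {p' : B' ⟶ Z} (hf' : f' ≫ p' = p) (h' : i' ≫ p' = 0) :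
    S.conflation (ShortComplex.mk i' p' h') := by
  have := epi_of_conflation hS
  have : Epi p' := by rw [← hf'] at this; exact epi_of_epi f' p'
  refine conflation_of_isInflation (S.isInflation_of_isPushout sq ⟨Z, p, h, hS⟩) h' fun k hk => ?_
  obtain ⟨t, ht⟩ := exists_desc_of_conflation hS (f' ≫ k) (by
    rw [← Category.assoc, sq.w, Category.assoc, hk, comp_zero])
  refine ⟨t, sq.hom_ext ?_ ?_⟩
  · rw [← Category.assoc, hf', ht]
  · rw [← Category.assoc, h', hk, zero_comp]

variable {S} in
/-- The pullback of a conflation. -/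
theorem conflation_of_isPullback {A B Z B' Z' : E} {i : A ⟶ B} {p : B ⟶ Z} {h : i ≫ p = 0}
    {f : Z' ⟶ Z} {f' : B' ⟶ B} {p' : B' ⟶ Z'} (hS : S.conflation (ShortComplex.mk i p h))
    (sq : IsPullback f' p' p f) {i' : A ⟶ B'} (hf' : i' ≫ f' = i) (h' : i' ≫ p' = 0) :
    S.conflation (ShortComplex.mk i' p' h') := by
  have := mono_of_conflation hS
  have : Mono i' := by rw [← hf'] at this; exact mono_of_mono i' f'
  refine conflation_of_isDeflation (S.isDeflation_of_isPullback sq ⟨A, i, h, hS⟩) h' fun k hk => ?_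
  obtain ⟨t, ht⟩ := exists_lift_of_conflation hS (k ≫ f') (by
    rw [Category.assoc, sq.w, ← Category.assoc, hk, zero_comp])
  refine ⟨t, sq.hom_ext ?_ ?_⟩
  · rw [Category.assoc, hf', ht]
  · rw [Category.assoc, h', hk, comp_zero]

/-- The cokernel of the inflation `𝟙 A` is both zero and epi, so its target is a zero object. -/
theorem isDeflation_of_isZero {A Z : E} (hZ : IsZero Z) (p : A ⟶ Z) : S.IsDeflation p := by
  obtain ⟨Z', q, h, hS⟩ := S.inflation_id A
  have hq : q = 0 := by simpa using h
  have := epi_of_conflation hS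
  have hZ' : IsZero Z' := by
    rw [IsZero.iff_id_eq_zero, ← cancel_epi q, hq, zero_comp, zero_comp]
  exact ⟨A, 𝟙 A, hZ.eq_of_tgt _ _, conflation_congr hS _
    (Iso.refl _) (Iso.refl _) (hZ'.iso hZ) (by simp) (hZ.eq_of_tgt _ _)⟩

theorem isInflation_of_isZero {A Z : E} (hA : IsZero A) (i : A ⟶ Z) : S.IsInflation i := by
  obtain ⟨A', q, h, hS⟩ := S.deflation_id Z
  have hq : q = 0 := by simpa using h
  have := mono_of_conflation hS
  have hA' : IsZero A' := by
    rw [IsZero.iff_id_eq_zero, ← cancel_mono q, hq, comp_zero, comp_zero]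
  exact ⟨Z, 𝟙 Z, hA.eq_of_src _ _, conflation_congr hS _
    (hA'.iso hA) (Iso.refl _) (Iso.refl _) (hA'.eq_of_src _ _) (by simp)⟩

end

/-! ### Inflations and deflations built from biproducts -/

section Biprod

variable {E : Type u} [Category.{v} E] [Preadditive E] [HasZeroObject E] [HasBinaryBiproducts E]
  (S : ExactStructure E)

theorem isDeflation_biprod_snd (M X : E) : S.IsDeflation (biprod.snd : M ⊞ X ⟶ X) :=
  S.isDeflation_of_isPullback (f := (0 : X ⟶ (HasZeroObject.zero' E).zero))
    (IsPullback.of_has_biproduct M X) (S.isDeflation_of_isZero (isZero_zero E) _)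

theorem isInflation_biprod_inr (M X : E) : S.IsInflation (biprod.inr : X ⟶ M ⊞ X) :=
  S.isInflation_of_isPushout (f := (0 : (HasZeroObject.zero' E).zero ⟶ X))
    (IsPushout.of_has_biproduct M X) (S.isInflation_of_isZero (isZero_zero E) _)

/-- The morphism factors as `𝟙 ⊕ p`, a pullback of `p`, followed by the shear of `M ⊞ X` given by
`m` and the projection to `X`. This produces the relative deflations later on. -/
theorem isDeflation_biprod_desc {M P X : E} (m : M ⟶ X) (p : P ⟶ X) (hp : S.IsDeflation p) :
    S.IsDeflation (biprod.desc m p) := by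
  have h₁ : S.IsDeflation (biprod.map (𝟙 M) p) := by
    refine S.isDeflation_of_isPullback (p := p) (f := biprod.snd) (f' := biprod.snd) ?_ hp
    refine ⟨⟨by simp⟩, ⟨PullbackCone.IsLimit.mk _ (fun s => biprod.lift (s.snd ≫ biprod.fst) s.fst)
      (fun s => by simp) (fun s => ?_) (fun s m h₁ h₂ => ?_)⟩⟩
    · ext
      · simp
      · simpa using s.condition
    · ext
      · simp [← h₂]
      · simp [← h₁]
  let e : M ⊞ X ≅ M ⊞ X :=
    ⟨biprod.lift biprod.fst (biprod.desc m (𝟙 X)), biprod.lift biprod.fst (biprod.desc (-m) (𝟙 X)),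
      by ext <;> simp, by ext <;> simp⟩
  have h₂ : biprod.desc m p = biprod.map (𝟙 M) p ≫ e.hom ≫ biprod.snd := by ext <;> simp [e]
  rw [h₂]
  exact S.deflation_comp _ _ h₁ (S.isDeflation_iso_comp e _ (S.isDeflation_biprod_snd M X))

theorem isInflation_biprod_lift {M P X : E} (m : X ⟶ M) (i : X ⟶ P) (hi : S.IsInflation i) :
    S.IsInflation (biprod.lift m i) := by
  have h₁ : S.IsInflation (biprod.map (𝟙 M) i) := by
    refine S.isInflation_of_isPushout (i := i) (f := biprod.inr) (f' := biprod.inr) ?_ hi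
    refine ⟨⟨by simp⟩, ⟨PushoutCocone.IsColimit.mk _
      (fun s => biprod.desc (biprod.inl ≫ s.inr) s.inl)
      (fun s => by simp) (fun s => ?_) (fun s m h₁ h₂ => ?_)⟩⟩
    · ext
      · simp
      · simpa using s.condition
    · ext
      · simp [← h₂]
      · simp [← h₁]
  let e : M ⊞ X ≅ M ⊞ X :=
    ⟨biprod.desc biprod.inl (biprod.lift m (𝟙 X)), biprod.desc biprod.inl (biprod.lift (-m) (𝟙 X)),
      by ext <;> simp, by ext <;> simp⟩
  have h₂ : biprod.lift m i = (biprod.inr ≫ e.hom) ≫ biprod.map (𝟙 M) i := by ext <;> simp [e]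
  rw [h₂]
  exact S.inflation_comp _ _ (S.isInflation_comp_iso _ e (S.isInflation_biprod_inr M X)) h₁

end Biprod

end ExactStructure

namespace FrobeniusStructure

variable {E : Type u} [Category.{v} E] [Preadditive E] [HasZeroObject E] [HasBinaryBiproducts E]
  (F : FrobeniusStructure E)

open ExactStructure

/-! ### Morphisms that vanish in the stable category -/

theorem toStable_map_eq_iff {X Y : E} {f g : X ⟶ Y} :
    F.toStable.map f = F.toStable.map g ↔ F.stableRel f g :=
  CategoryTheory.Quotient.functor_map_eq_iff _ _ _

theorem toStable_map_eq_zero_iff {X Y : E} {f : X ⟶ Y} :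
    F.toStable.map f = 0 ↔ F.stableRel f 0 := by
  rw [← F.toStable_map_eq_iff, Functor.map_zero]

theorem exists_toStable_map {X Y : E} (f : F.toStable.obj X ⟶ F.toStable.obj Y) :
    ∃ f' : X ⟶ Y, F.toStable.map f' = f :=
  F.toStable.map_surjective f

theorem toStable_map_comp_eq_zero {X Q Y : E} (hQ : F.projectives Q) (a : X ⟶ Q) (b : Q ⟶ Y) :
    F.toStable.map (a ≫ b) = 0 :=
  F.toStable_map_eq_zero_iff.2 ⟨Q, hQ, a, b, sub_zero _⟩

theorem toStable_map_comp_hull_eq_zero {X Q Y : E} (a : X ⟶ F.hull Q) (b : F.hull Q ⟶ Y) :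
    F.toStable.map (a ≫ b) = 0 :=
  F.toStable_map_comp_eq_zero ((F.projective_iff_injective _).2 (F.hull_injective Q)) a b

-- Stable vanishing becomes honest lifting: the projective object through which `f` factors lifts
-- along `p`.
variable {F} in
theorem exists_lift_of_map_eq_zero {T B Z : E} {p : B ⟶ Z} (hp : F.IsDeflation p) {f : T ⟶ Z}
    (hf : F.toStable.map f = 0) : ∃ g : T ⟶ B, g ≫ p = f := by
  obtain ⟨Q, hQ, a, b, hab⟩ := F.toStable_map_eq_zero_iff.1 hf
  obtain ⟨b', hb'⟩ := hQ p hp b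
  exact ⟨a ≫ b', by rw [Category.assoc, hb', ← hab, sub_zero]⟩

variable {F} in
theorem exists_extension_of_map_eq_zero {A B T : E} {i : A ⟶ B} (hi : F.IsInflation i)
    {f : A ⟶ T} (hf : F.toStable.map f = 0) : ∃ g : B ⟶ T, i ≫ g = f := by
  obtain ⟨Q, hQ, a, b, hab⟩ := F.toStable_map_eq_zero_iff.1 hf
  obtain ⟨a', ha'⟩ := (F.projective_iff_injective Q).1 hQ i hi a
  exact ⟨a' ≫ b, by rw [← Category.assoc, ha', ← hab, sub_zero]⟩

/-! ### Morphisms to suspensions -/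

/-- The class of a morphism `Z ⟶ cosyzygy A` as a morphism to the suspension of `A`. -/
noncomputable def toSuspension {Z A : E} (s : Z ⟶ F.cosyzygy A) :
    F.toStable.obj Z ⟶ F.suspension.obj (F.toStable.obj A) :=
  F.toStable.map s

theorem toSuspension_eq_iff {Z A : E} {s t : Z ⟶ F.cosyzygy A} :
    F.toSuspension s = F.toSuspension t ↔ F.toStable.map s = F.toStable.map t := Iff.rfl

theorem toSuspension_eq_zero_iff {Z A : E} {s : Z ⟶ F.cosyzygy A} :
    F.toSuspension s = 0 ↔ F.toStable.map s = 0 := Iff.rfl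

theorem exists_toSuspension {Z A : E}
    (ω : F.toStable.obj Z ⟶ F.suspension.obj (F.toStable.obj A)) :
    ∃ s : Z ⟶ F.cosyzygy A, F.toSuspension s = ω :=
  F.toStable.map_surjective (X := Z) (Y := F.cosyzygy A) ω

theorem map_comp_toSuspension {T Z A : E} (f : T ⟶ Z) (s : Z ⟶ F.cosyzygy A) :
    F.toStable.map f ≫ F.toSuspension s = F.toSuspension (f ≫ s) :=
  (F.toStable.map_comp f s).symm

variable {F} in
theorem suspension_map_eq {X Y : E} {g : X ⟶ Y} {t : F.cosyzygy X ⟶ F.cosyzygy Y}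
    (ht : F.IsCosyzygyLift g t) : F.suspension.map (F.toStable.map g) = F.toStable.map t :=
  F.cosyzygyLift_unique (F.stableRel_refl g) (F.exists_cosyzygyLift g).choose_spec ht

variable {F} in
theorem toSuspension_comp_suspension_map {T X Y : E} (v : T ⟶ F.cosyzygy X) {g : X ⟶ Y}
    {t : F.cosyzygy X ⟶ F.cosyzygy Y} (ht : F.IsCosyzygyLift g t) :
    F.toSuspension v ≫ F.suspension.map (F.toStable.map g) = F.toSuspension (v ≫ t) :=
  (congrArg (F.toStable.map v ≫ ·) (suspension_map_eq ht)).trans (F.toStable.map_comp _ _).symm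

/-! ### Connecting morphisms -/

/-- `s` is the composite of the connecting morphism `Z ⟶ cosyzygy A` of the conflation
`A ↣ B ↠ Z` with the morphism induced by `u : A ⟶ A'` on cosyzygies. -/
def IsConnecting {A B Z A' : E} (i : A ⟶ B) (p : B ⟶ Z) (u : A ⟶ A') (s : Z ⟶ F.cosyzygy A') :
    Prop :=
  ∃ e : B ⟶ F.hull A', i ≫ e = u ≫ F.hullMap A' ∧ p ≫ s = e ≫ F.cosyzygyMap A'

section

variable {F} {A B Z : E} {i : A ⟶ B} {p : B ⟶ Z} {h : i ≫ p = 0}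

theorem exists_isConnecting (hS : F.conflation (ShortComplex.mk i p h)) {A' : E} (u : A ⟶ A') :
    ∃ s : Z ⟶ F.cosyzygy A', F.IsConnecting i p u s := by
  obtain ⟨e, he⟩ := F.hull_injective A' i ⟨Z, p, h, hS⟩ (u ≫ F.hullMap A')
  obtain ⟨s, hs⟩ := exists_desc_of_conflation hS (e ≫ F.cosyzygyMap A') (by
    rw [← Category.assoc, he, Category.assoc, hullMap_cosyzygyMap, comp_zero])
  exact ⟨s, e, he, hs⟩

/-- Two choices differ by a morphism through `hull A'`. Identities between suspended morphisms are
proved below by exhibiting both sides as connecting morphisms of one conflation. -/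
theorem isConnecting_unique (hS : F.conflation (ShortComplex.mk i p h)) {A' : E} {u u' : A ⟶ A'}
    (hu : F.toStable.map u = F.toStable.map u') {s s' : Z ⟶ F.cosyzygy A'}
    (hs : F.IsConnecting i p u s) (hs' : F.IsConnecting i p u' s') :
    F.toSuspension s = F.toSuspension s' := by
  obtain ⟨e, he, hs⟩ := hs
  obtain ⟨e', he', hs'⟩ := hs'
  obtain ⟨x, hx⟩ := exists_extension_of_map_eq_zero (f := u - u') ⟨Z, p, h, hS⟩
    (by rw [Functor.map_sub, hu, sub_self])
  obtain ⟨r, hr⟩ := exists_desc_of_conflation hS (e - e' - x ≫ F.hullMap A') (by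
    rw [Preadditive.comp_sub, Preadditive.comp_sub, he, he', ← Category.assoc, hx,
      Preadditive.sub_comp, sub_self])
  rw [toSuspension_eq_iff, ← sub_eq_zero, ← Functor.map_sub]
  have := epi_of_conflation hS
  have hrs : s - s' = r ≫ F.cosyzygyMap A' := by
    rw [← cancel_epi p, Preadditive.comp_sub, hs, hs', ← Category.assoc, hr]
    simp [Preadditive.sub_comp, F.hullMap_cosyzygyMap]
  rw [hrs]
  exact F.toStable_map_comp_hull_eq_zero _ _

theorem IsConnecting.comp {A' A'' : E} {u : A ⟶ A'} {s : Z ⟶ F.cosyzygy A'}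
    (hs : F.IsConnecting i p u s) {g : A' ⟶ A''} {t : F.cosyzygy A' ⟶ F.cosyzygy A''}
    (ht : F.IsCosyzygyLift g t) : F.IsConnecting i p (u ≫ g) (s ≫ t) := by
  obtain ⟨e, he, hs⟩ := hs
  obtain ⟨e', he', ht⟩ := ht
  refine ⟨e ≫ e', ?_, ?_⟩
  · rw [← Category.assoc, he, Category.assoc, he', Category.assoc]
  · rw [← Category.assoc, hs, Category.assoc, ht, Category.assoc]

theorem IsConnecting.precomp {A₁ B₁ Z₁ A' : E} {i₁ : A₁ ⟶ B₁} {p₁ : B₁ ⟶ Z₁} {u : A₁ ⟶ A'}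
    {s : Z₁ ⟶ F.cosyzygy A'} (hs : F.IsConnecting i₁ p₁ u s) {a : A ⟶ A₁} {b : B ⟶ B₁}
    {z : Z ⟶ Z₁} (hi : i ≫ b = a ≫ i₁) (hp : p ≫ z = b ≫ p₁) :
    F.IsConnecting i p (a ≫ u) (z ≫ s) := by
  obtain ⟨e, he, hs⟩ := hs
  refine ⟨b ≫ e, ?_, ?_⟩
  · rw [← Category.assoc, hi, Category.assoc, he, Category.assoc]
  · rw [← Category.assoc, hp, Category.assoc, hs, Category.assoc]

theorem IsConnecting.map_comp_suspension (hS : F.conflation (ShortComplex.mk i p h)) {A' A'' : E}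
    {u : A ⟶ A'} {g : A' ⟶ A''} {s : Z ⟶ F.cosyzygy A'} {s' : Z ⟶ F.cosyzygy A''}
    (hs : F.IsConnecting i p u s) (hs' : F.IsConnecting i p (u ≫ g) s') :
    F.toSuspension s ≫ F.suspension.map (F.toStable.map g) = F.toSuspension s' := by
  obtain ⟨t, ht⟩ := F.exists_cosyzygyLift g
  rw [toSuspension_comp_suspension_map s ht]
  exact isConnecting_unique hS rfl (hs.comp ht) hs'

/-- The class is the obstruction to extending `u` over `i`: a lift of `s` to `hull A'` corrects `e`
so that it lands in `A'`, and conversely an extension of `u` corrects `e` so that it descends to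
`Z`. -/
theorem IsConnecting.map_eq_zero_iff (hS : F.conflation (ShortComplex.mk i p h)) {A' : E}
    {u : A ⟶ A'} {s : Z ⟶ F.cosyzygy A'} (hs : F.IsConnecting i p u s) :
    F.toSuspension s = 0 ↔ ∃ t : B ⟶ A', i ≫ t = u := by
  obtain ⟨e, he, hs⟩ := hs
  have := epi_of_conflation hS
  constructor
  · intro h0
    obtain ⟨g, hg⟩ := exists_lift_of_map_eq_zero ⟨_, _, _, F.hull_conflation A'⟩ h0
    obtain ⟨t, ht⟩ := exists_lift_of_conflation (F.hull_conflation A') (e - p ≫ g) (by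
      rw [Preadditive.sub_comp, Category.assoc, hg, hs, sub_self])
    have := mono_of_conflation (F.hull_conflation A')
    refine ⟨t, (cancel_mono (F.hullMap A')).1 ?_⟩
    rw [Category.assoc, ht, Preadditive.comp_sub, he, ← Category.assoc, h, zero_comp, sub_zero]
  · rintro ⟨t, ht⟩
    obtain ⟨g, hg⟩ := exists_desc_of_conflation hS (e - t ≫ F.hullMap A') (by
      rw [Preadditive.comp_sub, ← Category.assoc, ht, he, sub_self])
    have hsg : s = g ≫ F.cosyzygyMap A' := by
      rw [← cancel_epi p, hs, ← Category.assoc, hg]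
      simp [Preadditive.sub_comp, F.hullMap_cosyzygyMap]
    rw [hsg, toSuspension_eq_zero_iff]
    exact F.toStable_map_comp_hull_eq_zero _ _

/-- By naturality `f ≫ s` is the connecting morphism of the conflation pulled back along `f`. It
vanishes stably exactly when that conflation splits, that is, when `f` lifts. -/
theorem IsConnecting.map_comp_eq_zero_iff (hS : F.conflation (ShortComplex.mk i p h))
    {s : Z ⟶ F.cosyzygy A} (hs : F.IsConnecting i p (𝟙 A) s) {T : E} (f : T ⟶ Z) :
    F.toStable.map f ≫ F.toSuspension s = 0 ↔ ∃ g : T ⟶ B, g ≫ p = f := by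
  obtain ⟨B', f', p', sq, -⟩ := F.deflation_pullback p f ⟨A, i, h, hS⟩
  have hk := conflation_of_isPullback hS sq (i' := sq.lift i 0 (by simp [h])) (by simp)
    (by simp)
  have hs' : F.IsConnecting (sq.lift i 0 (by simp [h])) p' (𝟙 A) (f ≫ s) := by
    simpa using hs.precomp (a := 𝟙 A) (b := f') (by simp) sq.w.symm
  rw [map_comp_toSuspension, hs'.map_eq_zero_iff hk]
  constructor
  · rintro ⟨t, ht⟩
    obtain ⟨r, hr⟩ := exists_section_of_retraction hk ht
    exact ⟨r ≫ f', by rw [Category.assoc, sq.w, ← Category.assoc, hr, Category.id_comp]⟩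
  · rintro ⟨g, hg⟩
    obtain ⟨t, ht⟩ := exists_lift_of_conflation hS (f' - p' ≫ g) (by
      rw [Preadditive.sub_comp, Category.assoc, hg, sq.w, sub_self])
    have := mono_of_conflation hS
    refine ⟨t, (cancel_mono i).1 ?_⟩
    rw [Category.assoc, ht, Preadditive.comp_sub, ← Category.assoc _ p']
    simp

/-- Exactness of `Hom(T, A) ⟶ Hom(T, B) ⟶ Hom(T, Z)`. -/
theorem exists_map_comp_eq_of_comp_eq_zero (hS : F.conflation (ShortComplex.mk i p h)) {T : E}
    (f : T ⟶ B) (hf : F.toStable.map (f ≫ p) = 0) :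
    ∃ k : T ⟶ A, F.toStable.map (k ≫ i) = F.toStable.map f := by
  obtain ⟨Q, hQ, a, b, hab⟩ := F.toStable_map_eq_zero_iff.1 hf
  obtain ⟨b', hb'⟩ := hQ p ⟨A, i, h, hS⟩ b
  obtain ⟨k, hk⟩ := exists_lift_of_conflation hS (f - a ≫ b') (by
    rw [Preadditive.sub_comp, Category.assoc, hb', ← hab, sub_zero, sub_self])
  exact ⟨k, by rw [hk, Functor.map_sub, F.toStable_map_comp_eq_zero hQ, sub_zero]⟩

/-- Exactness of `Hom(T, Z) ⟶ Hom(T, ΣA) ⟶ Hom(T, ΣB)`. -/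
theorem IsConnecting.exists_map_comp_eq (h : i ≫ p = 0)
    {s : Z ⟶ F.cosyzygy A} (hs : F.IsConnecting i p (𝟙 A) s) {T : E}
    (v : F.toStable.obj T ⟶ F.suspension.obj (F.toStable.obj A))
    (hv : v ≫ F.suspension.map (F.toStable.map i) = 0) :
    ∃ z : T ⟶ Z, F.toStable.map z ≫ F.toSuspension s = v := by
  obtain ⟨v, rfl⟩ := F.exists_toSuspension v
  obtain ⟨e, he, hs⟩ := hs
  obtain ⟨t, ht⟩ := F.exists_cosyzygyLift i
  rw [toSuspension_comp_suspension_map v ht] at hv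
  have hH := F.hull_conflation A
  -- The conflation `A ↣ V ↠ T` with class `v` is realised as a pullback of the hull conflation. The
  -- hypothesis on `v` makes `i` extend to `y : V ⟶ B`, and `z` is the morphism induced by `y` on
  -- cokernels.
  obtain ⟨V, f', p', sq, -⟩ := F.deflation_pullback (F.cosyzygyMap A) v ⟨_, _, _, hH⟩
  have hk := conflation_of_isPullback hH sq
    (i' := sq.lift (F.hullMap A) 0 (by simp [F.hullMap_cosyzygyMap])) (by simp) (by simp)
  have hv' : F.IsConnecting (sq.lift (F.hullMap A) 0 (by simp [F.hullMap_cosyzygyMap])) p'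
      i (v ≫ t) := by
    simpa using IsConnecting.precomp (F := F) (s := t) (u := i) (a := 𝟙 A) (b := f') ht
      (by simp) sq.w.symm
  obtain ⟨y, hy⟩ := (hv'.map_eq_zero_iff hk).1 hv
  obtain ⟨z, hz⟩ := exists_desc_of_conflation hk (y ≫ p) (by rw [← Category.assoc, hy, h])
  obtain ⟨g, hg⟩ := exists_desc_of_conflation hk (y ≫ e - f') (by
    rw [Preadditive.comp_sub, ← Category.assoc, hy, he]; simp)
  have := epi_of_conflation hk
  refine ⟨z, ?_⟩
  rw [map_comp_toSuspension, toSuspension_eq_iff, ← sub_eq_zero, ← Functor.map_sub]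
  have : z ≫ s - v = g ≫ F.cosyzygyMap A := by
    rw [← cancel_epi p', ← Category.assoc, hg, Preadditive.comp_sub, ← Category.assoc, hz,
      Category.assoc, hs, Preadditive.sub_comp, sq.w, Category.assoc]
  rw [this]
  exact F.toStable_map_comp_hull_eq_zero _ _

/-- Exactness of `Hom(T, A) ⟶ Hom(T, A') ⟶ Hom(T, C)` for the pushout `C` of a conflation
`A ↣ B ↠ Z` along `A ⟶ A'`, applied to morphisms to `A'` that vanish in `C`. -/
theorem exists_map_comp_eq_of_isPushout (hS : F.conflation (ShortComplex.mk i p h)) {A' C : E}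
    {u : A ⟶ A'} {l : B ⟶ C} {j : A' ⟶ C} (sq : IsPushout i u l j) {T : E} (f : T ⟶ A')
    (hf : F.toStable.map (f ≫ j) = 0) :
    ∃ k : T ⟶ A, F.toStable.map (k ≫ u) = F.toStable.map f := by
  have hC := conflation_of_isPushout hS sq (p' := sq.desc p 0 (by simp [h])) (by simp)
    (by simp)
  have := mono_of_conflation hC
  obtain ⟨Q, hQ, x, y, hxy⟩ := F.toStable_map_eq_zero_iff.1 hf
  rw [sub_zero] at hxy
  -- Projectivity of `Q` writes `y` as `r ≫ l` plus a morphism `q` into `A'`. Subtracting `x ≫ q`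
  -- does not change `f` stably, and the remainder factors through `A` on the nose.
  obtain ⟨r, hr⟩ := hQ p ⟨A, i, h, hS⟩ (y ≫ sq.desc p 0 (by simp [h]))
  obtain ⟨q, hq⟩ := exists_lift_of_conflation hC (y - r ≫ l) (by
    rw [Preadditive.sub_comp, Category.assoc, sq.inl_desc, hr, sub_self])
  have hfx : (f - x ≫ q) ≫ j = (x ≫ r) ≫ l := by
    rw [Preadditive.sub_comp, hxy, Category.assoc, hq, Category.assoc, ← Preadditive.comp_sub]
    simp
  obtain ⟨k, hk⟩ := exists_lift_of_conflation hS (x ≫ r) (by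
    have := congr($hfx ≫ sq.desc p 0 (by simp [h]))
    simpa using this.symm)
  refine ⟨k, ?_⟩
  have hku : k ≫ u = f - x ≫ q := by
    rw [← cancel_mono j, hfx, Category.assoc, ← sq.w, ← Category.assoc, hk]
  rw [hku, Functor.map_sub, F.toStable_map_comp_eq_zero hQ, sub_zero]

end

/-! ### Additivity of the suspension and isomorphism invariance of triangles -/

instance : F.suspension.Additive where
  map_add {X Y} f g := by
    obtain ⟨f, rfl⟩ := F.exists_toStable_map f
    obtain ⟨g, rfl⟩ := F.exists_toStable_map g
    obtain ⟨s, hs⟩ := F.exists_cosyzygyLift f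
    obtain ⟨t, ht⟩ := F.exists_cosyzygyLift g
    rw [← Functor.map_add, suspension_map_eq hs, suspension_map_eq ht]
    refine (suspension_map_eq ?_).trans (F.toStable.map_add (f := s) (g := t))
    obtain ⟨e, he, hs⟩ := hs
    obtain ⟨e', he', ht⟩ := ht
    exact ⟨e + e', by simp [he, he', Preadditive.comp_add, Preadditive.add_comp],
      by simp [hs, ht, Preadditive.comp_add, Preadditive.add_comp]⟩

theorem IsDistinguished.of_iso {X Y Z X' Y' Z' : F.Stable} {f : X ⟶ Y} {g : Y ⟶ Z}
    {h : Z ⟶ F.suspension.obj X} {f' : X' ⟶ Y'} {g' : Y' ⟶ Z'} {h' : Z' ⟶ F.suspension.obj X'}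
    (α : X' ≅ X) (β : Y' ≅ Y) (γ : Z' ≅ Z) (H : F.IsDistinguished f g h)
    (hf : f' ≫ β.hom = α.hom ≫ f) (hg : g' ≫ γ.hom = β.hom ≫ g)
    (hh : h' ≫ F.suspension.map α.hom = γ.hom ≫ h) : F.IsDistinguished f' g' h' := by
  obtain ⟨A, B, C, u, j, w, α', β', γ', H, h₁, h₂, h₃⟩ := H
  refine ⟨A, B, C, u, j, w, α ≪≫ α', β ≪≫ β', γ ≪≫ γ', H, ?_, ?_, ?_⟩
  · simp [reassoc_of% hf, h₁]
  · simp [reassoc_of% hg, h₂]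
  · rw [Iso.trans_hom, Functor.map_comp, reassoc_of% hh, h₃, Iso.trans_hom, Category.assoc]
    rfl

end FrobeniusStructure

/-! ### Orthogonal decompositions -/

section Orthogonal

variable {C : Type u} [Category.{v} C] [Preadditive C]

/-- Two classes of objects, closed under isomorphisms and orthogonal to each other, such that
every object is a direct sum of objects of the two classes. -/
structure IsOrthogonalDecomposition (P₁ P₂ : ObjectProperty C) : Prop where
  isoClosed_left : P₁.IsClosedUnderIsomorphisms
  isoClosed_right : P₂.IsClosedUnderIsomorphisms
  hom_left_right : ∀ ⦃X Y : C⦄, P₁ X → P₂ Y → ∀ f : X ⟶ Y, f = 0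
  hom_right_left : ∀ ⦃X Y : C⦄, P₂ X → P₁ Y → ∀ f : X ⟶ Y, f = 0
  exists_decomposition : ∀ X : C, ∃ (X₁ X₂ : C) (i₁ : X₁ ⟶ X) (p₁ : X ⟶ X₁) (i₂ : X₂ ⟶ X)
    (p₂ : X ⟶ X₂), P₁ X₁ ∧ P₂ X₂ ∧ i₁ ≫ p₁ = 𝟙 X₁ ∧ i₂ ≫ p₂ = 𝟙 X₂ ∧ p₁ ≫ i₁ + p₂ ≫ i₂ = 𝟙 X

theorem Triangulation.IsDirectSum.isOrthogonalDecomposition {T : Triangulation C}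
    {P₁ P₂ : ObjectProperty C} (h : T.IsDirectSum P₁ P₂) : IsOrthogonalDecomposition P₁ P₂ where
  isoClosed_left := h.left.isoClosed
  isoClosed_right := h.right.isoClosed
  hom_left_right := h.hom_left_right
  hom_right_left := h.hom_right_left
  exists_decomposition X := by
    obtain ⟨X₁, X₂, b, h₁, h₂, ⟨hb⟩, ⟨e⟩⟩ := h.decomposition X
    refine ⟨X₁, X₂, b.inl ≫ e.inv, e.hom ≫ b.fst, b.inr ≫ e.inv, e.hom ≫ b.snd, h₁, h₂, by simp,
      by simp, ?_⟩
    have := IsBilimit.binary_total hb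
    simp only [Category.assoc]
    rw [← Preadditive.comp_add, ← Category.assoc, ← Category.assoc b.snd, ← Preadditive.add_comp,
      this]
    simp

namespace IsOrthogonalDecomposition

variable {P₁ P₂ : ObjectProperty C}

theorem symm (D : IsOrthogonalDecomposition P₁ P₂) : IsOrthogonalDecomposition P₂ P₁ where
  isoClosed_left := D.isoClosed_right
  isoClosed_right := D.isoClosed_left
  hom_left_right := D.hom_right_left
  hom_right_left := D.hom_left_right
  exists_decomposition X := by
    obtain ⟨X₁, X₂, i₁, p₁, i₂, p₂, h₁, h₂, e₁, e₂, e⟩ := D.exists_decomposition X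
    exact ⟨X₂, X₁, i₂, p₂, i₁, p₁, h₂, h₁, e₂, e₁, by rw [add_comm, e]⟩

/-- The inclusion of the `P₂`-component is then zero, so `X` is isomorphic to its `P₁`-component.
Each summand is thus recovered as an orthogonal of the other. -/
theorem left_of_hom_from_right_eq_zero (D : IsOrthogonalDecomposition P₁ P₂) {X : C}
    (hX : ∀ Y, P₂ Y → ∀ f : Y ⟶ X, f = 0) : P₁ X := by
  obtain ⟨X₁, X₂, i₁, p₁, i₂, p₂, h₁, h₂, e₁, e₂, e⟩ := D.exists_decomposition X
  rw [hX _ h₂ i₂, comp_zero, add_zero] at e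
  have := D.isoClosed_left
  exact P₁.prop_of_iso ⟨i₁, p₁, e₁, e⟩ h₁

theorem left_of_hom_to_right_eq_zero (D : IsOrthogonalDecomposition P₁ P₂) {X : C}
    (hX : ∀ Y, P₂ Y → ∀ f : X ⟶ Y, f = 0) : P₁ X := by
  obtain ⟨X₁, X₂, i₁, p₁, i₂, p₂, h₁, h₂, e₁, e₂, e⟩ := D.exists_decomposition X
  rw [hX _ h₂ p₂, zero_comp, add_zero] at e
  have := D.isoClosed_left
  exact P₁.prop_of_iso ⟨i₁, p₁, e₁, e⟩ h₁

end IsOrthogonalDecomposition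

/-- Yoneda inside the full subcategory `P`: test objects in `P` suffice because both ends lie in
`P`. -/
theorem isIso_of_forall_bijective {P : ObjectProperty C} {X Y : C} (hX : P X) (hY : P Y)
    (f : X ⟶ Y) (hf : ∀ T, P T → Function.Bijective (fun g : T ⟶ X => g ≫ f)) : IsIso f := by
  obtain ⟨g, hg⟩ := (hf Y hY).2 (𝟙 Y)
  dsimp only at hg
  exact ⟨g, (hf X hX).1 (by simp [hg]), hg⟩

end Orthogonal

/-! ### Restriction of Serre functors -/

section Serre

variable {k : Type w} [Field k] {C : Type u} [Category.{v} C] [Preadditive C] [Linear k C]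

/-- The Hom spaces of a full subcategory are those of the ambient category. -/
def fullSubcategoryHomEquiv (P : ObjectProperty C) (X Y : P.FullSubcategory) :
    (X ⟶ Y) ≃ₗ[k] (X.obj ⟶ Y.obj) where
  toFun f := f.hom
  invFun f := ObjectProperty.homMk f
  left_inv _ := rfl
  right_inv _ := rfl
  map_add' _ _ := rfl
  map_smul' _ _ := rfl

/-- The restriction of a Serre duality to a full subcategory. -/
noncomputable def SerreDuality.restrict {S : C ⥤ C} (d : SerreDuality k S) (P : ObjectProperty C)
    (hP : ∀ X, P X → P (S.obj X)) :
    SerreDuality k (P.lift (P.ι ⋙ S) (fun X => hP _ X.property)) where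
  iso X Y := (fullSubcategoryHomEquiv P X Y).trans ((d.iso X.obj Y.obj).trans
    (fullSubcategoryHomEquiv P Y ((P.lift (P.ι ⋙ S) (fun X => hP _ X.property)).obj X)).dualMap)
  natural_left a f t := d.natural_left a.hom f.hom t.hom
  natural_right f b t := d.natural_right f.hom b.hom t.hom

theorem SerreDuality.eq_zero_of_forall_dual_eq_zero {S : C ⥤ C} (d : SerreDuality k S) {X Y : C}
    (h : ∀ f : Y ⟶ S.obj X, f = 0) (f : X ⟶ Y) : f = 0 := by
  apply (d.iso X Y).injective
  rw [map_zero]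
  ext t
  rw [h t, map_zero, LinearMap.zero_apply]

/-- Every functional on `Hom(Y, SX)` comes from `Hom(X, Y) = 0`, and functionals separate vectors in
any dimension. -/
theorem SerreDuality.eq_zero_of_forall_hom_eq_zero {S : C ⥤ C} (d : SerreDuality k S) {X Y : C}
    (h : ∀ f : X ⟶ Y, f = 0) (f : Y ⟶ S.obj X) : f = 0 := by
  rw [← Module.forall_dual_apply_eq_zero_iff k]
  intro φ
  obtain ⟨g, rfl⟩ := (d.iso X Y).surjective φ
  rw [h g, map_zero, LinearMap.zero_apply]

theorem IsOrthogonalDecomposition.serre_obj {P₁ P₂ : ObjectProperty C}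
    (D : IsOrthogonalDecomposition P₁ P₂) {S : C ⥤ C} (hS : IsSerreFunctor k S) (X : C)
    (hX : P₁ X) : P₁ (S.obj X) := by
  obtain ⟨d⟩ := hS.duality
  exact D.left_of_hom_from_right_eq_zero fun Y hY f =>
    d.eq_zero_of_forall_hom_eq_zero (D.hom_left_right hX hY) f

theorem IsOrthogonalDecomposition.isSerreFunctor_restrict {P₁ P₂ : ObjectProperty C}
    (D : IsOrthogonalDecomposition P₁ P₂) {S : C ⥤ C} (hS : IsSerreFunctor k S)
    (h : ∀ X, P₁ X → P₁ (S.obj X)) :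
    IsSerreFunctor k (P₁.lift (P₁.ι ⋙ S) (fun X => h _ X.property)) := by
  obtain ⟨d⟩ := hS.duality
  have := hS.isEquivalence
  have := hS.additive
  have := hS.linear
  have := D.isoClosed_left
  refine ⟨⟨inferInstance, inferInstance, ⟨fun Y => ?_⟩⟩, ⟨?_⟩, ⟨?_⟩, ⟨d.restrict P₁ h⟩⟩
  -- Only essential surjectivity needs an argument: a preimage `W` of `Y` lies in `P₁`, since for
  -- `Z` in `P₂` the space `Hom(W, Z)` is dual to `Hom(Z, SW)`, where `SW ≅ Y`.
  · refine ⟨⟨S.objPreimage Y.obj, ?_⟩, ⟨P₁.isoMk (S.objObjPreimageIso Y.obj)⟩⟩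
    refine D.left_of_hom_to_right_eq_zero fun Z hZ f => d.eq_zero_of_forall_dual_eq_zero (fun g => ?_) f
    exact D.hom_right_left hZ (P₁.prop_of_iso (S.objObjPreimageIso Y.obj).symm Y.property) g
  · intro X Y f g
    exact P₁.hom_ext (S.map_add)
  · intro X Y f r
    exact P₁.hom_ext (S.map_smul r f.hom)

end Serre

namespace FrobeniusStructure

open ExactStructure

variable {E : Type u} [Category.{v} E] [Preadditive E] [HasZeroObject E] [HasBinaryBiproducts E]
  (F : FrobeniusStructure E)

/-! ### The exact structure relative to a summand of the stable category -/

/-- The conflations `A ↣ B ↠ Z` such that every morphism to `Z` from an object whose stable class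
lies in `P` lifts to `B`. -/
def relativeConflation (P : ObjectProperty F.Stable) : ObjectProperty (ShortComplex E) := fun S =>
  F.conflation S ∧ ∀ M : E, P (F.toStable.obj M) → ∀ f : M ⟶ S.X₃, ∃ g : M ⟶ S.X₂, g ≫ S.g = f

variable {F} {P₁ P₂ : ObjectProperty F.Stable}

/-- The lifting property against the objects of a summand is equivalent to the extension
property. -/
theorem forall_lift_iff_forall_extension (D : IsOrthogonalDecomposition P₁ P₂)
    (h₁ : ∀ X, P₁ X → P₁ (F.suspension.obj X)) (h₂ : ∀ X, P₂ X → P₂ (F.suspension.obj X))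
    {A B Z : E} {i : A ⟶ B} {p : B ⟶ Z} {h : i ≫ p = 0}
    (hS : F.conflation (ShortComplex.mk i p h)) :
    (∀ M : E, P₂ (F.toStable.obj M) → ∀ f : M ⟶ Z, ∃ g : M ⟶ B, g ≫ p = f) ↔
      ∀ M : E, P₂ (F.toStable.obj M) → ∀ f : A ⟶ M, ∃ g : B ⟶ M, i ≫ g = f := by
  obtain ⟨s, hs⟩ := exists_isConnecting hS (𝟙 A)
  have ext_iff : ∀ {M : E} (f : A ⟶ M), (∃ g : B ⟶ M, i ≫ g = f) ↔
      F.toSuspension s ≫ F.suspension.map (F.toStable.map f) = 0 := fun f => by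
    obtain ⟨s', hs'⟩ := exists_isConnecting hS f
    rw [← hs'.map_eq_zero_iff hS, hs.map_comp_suspension hS (by simpa using hs')]
  simp only [← hs.map_comp_eq_zero_iff hS, ext_iff]
  generalize F.toSuspension s = ω
  constructor
  -- Split the identity of `Z`: the `P₂`-part is killed by `H`, and the `P₁`-part gives a morphism
  -- from `P₁` to `ΣM` in `P₂`. The converse splits the identity of `A` instead.
  · intro H M hM f
    obtain ⟨X₁, X₂, i₁, p₁, i₂, p₂, hX₁, hX₂, -, -, e⟩ := D.exists_decomposition (F.toStable.obj Z)
    obtain ⟨i₂, rfl⟩ := F.exists_toStable_map (X := X₂.as) i₂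
    rw [← Category.id_comp ω, ← e, Preadditive.add_comp, Preadditive.add_comp]
    simp only [Category.assoc]
    rw [reassoc_of% (H _ hX₂ i₂), D.hom_left_right hX₁ (h₂ _ hM) (i₁ ≫ ω ≫ _)]
    simp
  · intro H M hM f
    obtain ⟨X₁, X₂, i₁, p₁, i₂, p₂, hX₁, hX₂, -, -, e⟩ := D.exists_decomposition (F.toStable.obj A)
    obtain ⟨p₂, rfl⟩ := F.exists_toStable_map (Y := X₂.as) p₂
    rw [← Category.comp_id ω, ← F.suspension.map_id, ← e, Functor.map_add, Preadditive.comp_add,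
      Preadditive.comp_add, Functor.map_comp, Functor.map_comp, reassoc_of% (H _ hX₂ p₂),
      ← Category.assoc ω, ← Category.assoc (F.toStable.map f),
      D.hom_right_left hM (h₁ _ hX₁) (F.toStable.map f ≫ ω ≫ _)]
    simp

section

theorem isInflationOf_relativeConflation_iff (D : IsOrthogonalDecomposition P₁ P₂)
    (h₁ : ∀ X, P₁ X → P₁ (F.suspension.obj X)) (h₂ : ∀ X, P₂ X → P₂ (F.suspension.obj X))
    {A B : E} (i : A ⟶ B) :
    IsInflationOf (F.relativeConflation P₂) i ↔ F.IsInflation i ∧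
      ∀ M : E, P₂ (F.toStable.obj M) → ∀ f : A ⟶ M, ∃ g : B ⟶ M, i ≫ g = f := by
  constructor
  · rintro ⟨Z, p, h, hS, hM⟩
    exact ⟨⟨Z, p, h, hS⟩, (forall_lift_iff_forall_extension D h₁ h₂ hS).1 hM⟩
  · rintro ⟨⟨Z, p, h, hS⟩, hM⟩
    exact ⟨Z, p, h, hS, (forall_lift_iff_forall_extension D h₁ h₂ hS).2 hM⟩

theorem isDeflationOf_relativeConflation_iff {B Z : E} (p : B ⟶ Z) :
    IsDeflationOf (F.relativeConflation P₂) p ↔ F.IsDeflation p ∧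
      ∀ M : E, P₂ (F.toStable.obj M) → ∀ f : M ⟶ Z, ∃ g : M ⟶ B, g ≫ p = f := by
  constructor
  · rintro ⟨A, i, h, hS, hM⟩
    exact ⟨⟨A, i, h, hS⟩, hM⟩
  · rintro ⟨⟨A, i, h, hS⟩, hM⟩
    exact ⟨A, i, h, hS, hM⟩

/-- The exact structure given by the relative conflations. -/
def relativeExactStructure (D : IsOrthogonalDecomposition P₁ P₂)
    (h₁ : ∀ X, P₁ X → P₁ (F.suspension.obj X)) (h₂ : ∀ X, P₂ X → P₂ (F.suspension.obj X)) :
    ExactStructure E where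
  conflation := F.relativeConflation P₂
  conflation_of_iso {S T} e hS := ⟨F.conflation_of_iso e hS.1, fun M hM f => by
    obtain ⟨g, hg⟩ := hS.2 M hM (f ≫ e.inv.τ₃)
    refine ⟨g ≫ e.hom.τ₂, ?_⟩
    rw [Category.assoc, e.hom.comm₂₃, reassoc_of% hg, ← ShortComplex.comp_τ₃, e.inv_hom_id,
      ShortComplex.id_τ₃, Category.comp_id]⟩
  isKernel S hS := F.isKernel S hS.1
  isCokernel S hS := F.isCokernel S hS.1
  inflation_id A := (isInflationOf_relativeConflation_iff D h₁ h₂ _).2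
    ⟨F.inflation_id A, fun _ _ f => ⟨f, Category.id_comp f⟩⟩
  deflation_id A := (isDeflationOf_relativeConflation_iff _).2
    ⟨F.deflation_id A, fun _ _ f => ⟨f, Category.comp_id f⟩⟩
  inflation_comp i j hi hj := by
    rw [isInflationOf_relativeConflation_iff D h₁ h₂] at hi hj ⊢
    refine ⟨F.inflation_comp i j hi.1 hj.1, fun M hM f => ?_⟩
    obtain ⟨g, rfl⟩ := hi.2 M hM f
    obtain ⟨g', rfl⟩ := hj.2 M hM g
    exact ⟨g', by simp⟩
  deflation_comp p q hp hq := by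
    rw [isDeflationOf_relativeConflation_iff] at hp hq ⊢
    refine ⟨F.deflation_comp p q hp.1 hq.1, fun M hM f => ?_⟩
    obtain ⟨g, rfl⟩ := hq.2 M hM f
    obtain ⟨g', rfl⟩ := hp.2 M hM g
    exact ⟨g', by simp⟩
  inflation_pushout i f hi := by
    rw [isInflationOf_relativeConflation_iff D h₁ h₂] at hi
    obtain ⟨B', f', i', sq, hi'⟩ := F.inflation_pushout i f hi.1
    refine ⟨B', f', i', sq, (isInflationOf_relativeConflation_iff D h₁ h₂ _).2
      ⟨hi', fun M hM g => ?_⟩⟩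
    obtain ⟨t, ht⟩ := hi.2 M hM (f ≫ g)
    exact ⟨sq.desc t g ht, by simp⟩
  deflation_pullback p f hp := by
    rw [isDeflationOf_relativeConflation_iff] at hp
    obtain ⟨B', f', p', sq, hp'⟩ := F.deflation_pullback p f hp.1
    refine ⟨B', f', p', sq, (isDeflationOf_relativeConflation_iff _).2
      ⟨hp', fun M hM g => ?_⟩⟩
    obtain ⟨t, ht⟩ := hp.2 M hM (g ≫ f)
    exact ⟨sq.lift t g ht, by simp⟩

/-! ### Relative projective and injective objects -/

theorem right_toStable_biprod (D : IsOrthogonalDecomposition P₁ P₂) {M Q : E}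
    (hM : P₂ (F.toStable.obj M)) (hQ : F.projectives Q) : P₂ (F.toStable.obj (M ⊞ Q)) := by
  refine D.symm.left_of_hom_from_right_eq_zero fun Y hY f => ?_
  rw [← Category.comp_id f, ← F.toStable.map_id, ← biprod.total, Functor.map_add,
    Preadditive.comp_add, F.toStable_map_comp_eq_zero hQ, comp_zero, add_zero, Functor.map_comp,
    ← Category.assoc, D.hom_left_right hY hM (f ≫ _), zero_comp]

/-- The summand `Q` makes the morphism a deflation, and the `P₂`-component of `X` makes it relative:
a morphism from `P₂` agrees stably with its part through that component, and the difference lifts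
along `p`. -/
theorem exists_relative_deflation (D : IsOrthogonalDecomposition P₁ P₂) (X : E) :
    ∃ (M : E) (p : M ⟶ X), P₂ (F.toStable.obj M) ∧ IsDeflationOf (F.relativeConflation P₂) p := by
  obtain ⟨X₁, X₂, i₁, p₁, i₂, p₂, hX₁, hX₂, -, -, e⟩ := D.exists_decomposition (F.toStable.obj X)
  obtain ⟨m, rfl⟩ := F.exists_toStable_map (X := X₂.as) i₂
  obtain ⟨r, rfl⟩ := F.exists_toStable_map (Y := X₂.as) p₂
  obtain ⟨Q, p, hQ, hp⟩ := F.enough_projectives X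
  refine ⟨X₂.as ⊞ Q, biprod.desc m p, right_toStable_biprod D hX₂ hQ,
    (isDeflationOf_relativeConflation_iff _).2 ⟨F.isDeflation_biprod_desc m p hp,
      fun M hM f => ?_⟩⟩
  obtain ⟨t, ht⟩ := exists_lift_of_map_eq_zero hp (f := f - f ≫ r ≫ m) (by
    rw [Functor.map_sub, Functor.map_comp, Functor.map_comp, sub_eq_zero]
    conv_lhs => rw [← Category.comp_id (F.toStable.map f), ← e, Preadditive.comp_add,
      ← Category.assoc, D.hom_right_left hM hX₁ (F.toStable.map f ≫ p₁), zero_comp, zero_add])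
  exact ⟨biprod.lift (f ≫ r) t, by simp [ht]⟩

theorem exists_relative_inflation (D : IsOrthogonalDecomposition P₁ P₂)
    (h₁ : ∀ X, P₁ X → P₁ (F.suspension.obj X)) (h₂ : ∀ X, P₂ X → P₂ (F.suspension.obj X))
    (X : E) :
    ∃ (M : E) (i : X ⟶ M), P₂ (F.toStable.obj M) ∧ IsInflationOf (F.relativeConflation P₂) i := by
  obtain ⟨X₁, X₂, i₁, p₁, i₂, p₂, hX₁, hX₂, -, -, e⟩ := D.exists_decomposition (F.toStable.obj X)
  obtain ⟨m, rfl⟩ := F.exists_toStable_map (X := X₂.as) i₂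
  obtain ⟨r, rfl⟩ := F.exists_toStable_map (Y := X₂.as) p₂
  refine ⟨X₂.as ⊞ F.hull X, biprod.lift r (F.hullMap X), right_toStable_biprod D hX₂
    ((F.projective_iff_injective _).2 (F.hull_injective X)),
    (isInflationOf_relativeConflation_iff D h₁ h₂ _).2
      ⟨F.isInflation_biprod_lift r _ (F.hullMap_inflation X), fun M hM f => ?_⟩⟩
  obtain ⟨t, ht⟩ := exists_extension_of_map_eq_zero (F.hullMap_inflation X) (f := f - r ≫ m ≫ f) (by
    rw [Functor.map_sub, Functor.map_comp, Functor.map_comp, sub_eq_zero]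
    conv_lhs => rw [← Category.id_comp (F.toStable.map f), ← e, Preadditive.add_comp,
      Category.assoc, D.hom_left_right hX₁ hM (i₁ ≫ F.toStable.map f), comp_zero, zero_add,
      Category.assoc])
  exact ⟨biprod.desc (m ≫ f) t, by simp [ht]⟩

theorem right_of_retract (D : IsOrthogonalDecomposition P₁ P₂) {X M : E}
    (hM : P₂ (F.toStable.obj M)) (a : X ⟶ M) (b : M ⟶ X) (hab : a ≫ b = 𝟙 X) :
    P₂ (F.toStable.obj X) := by
  refine D.symm.left_of_hom_from_right_eq_zero fun Y hY f => ?_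
  rw [← Category.comp_id f, ← F.toStable.map_id, ← hab, Functor.map_comp, ← Category.assoc,
    D.hom_left_right hY hM (f ≫ _), zero_comp]

variable (D : IsOrthogonalDecomposition P₁ P₂)
    (h₁ : ∀ X, P₁ X → P₁ (F.suspension.obj X)) (h₂ : ∀ X, P₂ X → P₂ (F.suspension.obj X))

/-- A relative projective splits its relative deflation from an object over `P₂`, hence is a retract
of it. -/
theorem relativeExactStructure_projectives (X : E) :
    (relativeExactStructure D h₁ h₂).projectives X ↔ P₂ (F.toStable.obj X) := by
  constructor
  · intro hX
    obtain ⟨M, p, hM, hp⟩ := exists_relative_deflation D X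
    obtain ⟨s, hs⟩ := hX p hp (𝟙 X)
    exact right_of_retract D hM s p hs
  · rintro hX B Z p hp f
    exact ((isDeflationOf_relativeConflation_iff p).1 hp).2 X hX f

theorem relativeExactStructure_injectives (X : E) :
    (relativeExactStructure D h₁ h₂).injectives X ↔ P₂ (F.toStable.obj X) := by
  constructor
  · intro hX
    obtain ⟨M, i, hM, hi⟩ := exists_relative_inflation D h₁ h₂ X
    obtain ⟨s, hs⟩ := hX i hi (𝟙 X)
    exact right_of_retract D hM i s hs
  · rintro hX A B i hi f
    exact ((isInflationOf_relativeConflation_iff D h₁ h₂ i).1 hi).2 X hX f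

/-- The relative exact structure is Frobenius, and its projective objects are the objects whose
stable class lies in the summand `P₂`. -/
def relative : FrobeniusStructure E where
  toExactStructure := relativeExactStructure D h₁ h₂
  enough_projectives X := by
    obtain ⟨M, p, hM, hp⟩ := exists_relative_deflation D X
    exact ⟨M, p, (relativeExactStructure_projectives D h₁ h₂ M).2 hM, hp⟩
  enough_injectives X := by
    obtain ⟨M, i, hM, hi⟩ := exists_relative_inflation D h₁ h₂ X
    exact ⟨M, i, (relativeExactStructure_injectives D h₁ h₂ M).2 hM, hi⟩
  projective_iff_injective X := by
    rw [relativeExactStructure_projectives, relativeExactStructure_injectives]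

end

end FrobeniusStructure

namespace FrobeniusStructure

open ExactStructure

variable {E : Type u} [Category.{v} E] [Preadditive E] [HasZeroObject E] [HasBinaryBiproducts E]
  {F : FrobeniusStructure E} {P₁ P₂ : ObjectProperty F.Stable}
  (D : IsOrthogonalDecomposition P₁ P₂)
  (h₁ : ∀ X, P₁ X → P₁ (F.suspension.obj X)) (h₂ : ∀ X, P₂ X → P₂ (F.suspension.obj X))

/-! ### The component of an object in a summand of the stable category -/

theorem exists_component (D : IsOrthogonalDecomposition P₁ P₂) (A : E) :
    ∃ (A₁ : E) (i : A₁ ⟶ A) (p : A ⟶ A₁), P₁ (F.toStable.obj A₁) ∧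
      F.toStable.map i ≫ F.toStable.map p = 𝟙 _ ∧ ∃ (A₂ : E) (a : A ⟶ A₂) (b : A₂ ⟶ A),
        P₂ (F.toStable.obj A₂) ∧ F.toStable.map p ≫ F.toStable.map i +
          F.toStable.map a ≫ F.toStable.map b = 𝟙 _ := by
  obtain ⟨⟨A₁⟩, ⟨A₂⟩, i₁, p₁, i₂, p₂, hA₁, hA₂, e₁, -, e⟩ :=
    D.exists_decomposition (F.toStable.obj A)
  obtain ⟨i, rfl⟩ := F.exists_toStable_map i₁
  obtain ⟨p, rfl⟩ := F.exists_toStable_map p₁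
  obtain ⟨b, rfl⟩ := F.exists_toStable_map i₂
  obtain ⟨a, rfl⟩ := F.exists_toStable_map p₂
  exact ⟨A₁, i, p, hA₁, e₁, A₂, a, b, hA₂, e⟩

/-- An object representing the component in `P₁` of the stable class of `A`. -/
noncomputable def component (A : E) : E := (exists_component D A).choose

/-- A morphism representing the inclusion of the component in `P₁`. -/
noncomputable def incl (A : E) : component D A ⟶ A := (exists_component D A).choose_spec.choose

/-- A morphism representing the projection to the component in `P₁`. -/
noncomputable def proj (A : E) : A ⟶ component D A :=
  (exists_component D A).choose_spec.choose_spec.choose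

theorem component_prop (A : E) : P₁ (F.toStable.obj (component D A)) :=
  (exists_component D A).choose_spec.choose_spec.choose_spec.1

@[simp]
theorem incl_proj (A : E) : F.toStable.map (incl D A) ≫ F.toStable.map (proj D A) = 𝟙 _ :=
  (exists_component D A).choose_spec.choose_spec.choose_spec.2.1

@[simp]
theorem incl_proj_assoc (A : E) {Z : F.Stable} (f : F.toStable.obj (component D A) ⟶ Z) :
    F.toStable.map (incl D A) ≫ F.toStable.map (proj D A) ≫ f = f := by
  rw [← Category.assoc, incl_proj, Category.id_comp]

theorem exists_complement (A : E) : ∃ (A₂ : E) (a : A ⟶ A₂) (b : A₂ ⟶ A),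
    P₂ (F.toStable.obj A₂) ∧ F.toStable.map (proj D A) ≫ F.toStable.map (incl D A) +
      F.toStable.map a ≫ F.toStable.map b = 𝟙 _ :=
  (exists_component D A).choose_spec.choose_spec.choose_spec.2.2

/-- The complementary idempotent factors through `P₂`, so it kills every morphism from `P₁`. -/
theorem comp_proj_incl {T : F.Stable} {A : E} (hT : P₁ T) (f : T ⟶ F.toStable.obj A) :
    f ≫ F.toStable.map (proj D A) ≫ F.toStable.map (incl D A) = f := by
  obtain ⟨Y, a, b, hY, e⟩ := exists_complement D A
  conv_rhs => rw [← Category.comp_id f, ← e, Preadditive.comp_add,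
    ← Category.assoc f (F.toStable.map a), D.hom_left_right hT hY (f ≫ F.toStable.map a),
    zero_comp, add_zero]

theorem proj_incl_comp {T : F.Stable} {A : E} (hT : P₁ T) (f : F.toStable.obj A ⟶ T) :
    F.toStable.map (proj D A) ≫ F.toStable.map (incl D A) ≫ f = f := by
  obtain ⟨Y, a, b, hY, e⟩ := exists_complement D A
  conv_rhs => rw [← Category.id_comp f, ← e, Preadditive.add_comp, Category.assoc,
    Category.assoc (F.toStable.map a), D.hom_right_left hY hT (F.toStable.map b ≫ f),
    comp_zero, add_zero]

theorem comp_proj_incl_comp {T Y : F.Stable} {A : E} (hT : P₁ T) (f : T ⟶ F.toStable.obj A)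
    (g : F.toStable.obj A ⟶ Y) :
    f ≫ F.toStable.map (proj D A) ≫ F.toStable.map (incl D A) ≫ g = f ≫ g := by
  conv_rhs => rw [← comp_proj_incl D hT f]
  simp only [Category.assoc]

include h₂ in
theorem comp_suspension_proj_incl {T : F.Stable} {A : E} (hT : P₁ T)
    (f : T ⟶ F.suspension.obj (F.toStable.obj A)) :
    f ≫ F.suspension.map (F.toStable.map (proj D A)) ≫
      F.suspension.map (F.toStable.map (incl D A)) = f := by
  obtain ⟨Y, a, b, hY, e⟩ := exists_complement D A
  conv_rhs => rw [← Category.comp_id f, ← F.suspension.map_id, ← e, Functor.map_add,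
    Preadditive.comp_add, Functor.map_comp, Functor.map_comp,
    ← Category.assoc f (F.suspension.map (F.toStable.map a)),
    D.hom_left_right hT (h₂ _ hY) (f ≫ F.suspension.map (F.toStable.map a)), zero_comp, add_zero]

theorem bijective_comp_incl {T : F.Stable} (hT : P₁ T) (A : E) : Function.Bijective
    (fun f : T ⟶ F.toStable.obj (component D A) => f ≫ F.toStable.map (incl D A)) := by
  constructor
  · intro f g hfg
    simpa using congr($hfg ≫ F.toStable.map (proj D A))
  · intro f
    exact ⟨f ≫ F.toStable.map (proj D A), by simpa using comp_proj_incl D hT f⟩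

/-- The `P₁`-component kills morphisms through `P₂`. Conversely, if `f - g` dies there, it agrees
stably with its part through the complement of `Y`, and the error passes through a projective `Q`;
the sum of the complement and `Q` is relatively projective. -/
theorem relative_stableRel_iff {X Y : E} (f g : X ⟶ Y) :
    (relative D h₁ h₂).stableRel f g ↔
      F.toStable.map f ≫ F.toStable.map (proj D Y) =
        F.toStable.map g ≫ F.toStable.map (proj D Y) := by
  rw [← sub_eq_zero, ← Preadditive.sub_comp, ← Functor.map_sub]
  constructor
  · rintro ⟨M, hM, a, b, hab⟩
    rw [hab, Functor.map_comp, Category.assoc, D.hom_right_left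
      ((relativeExactStructure_projectives D h₁ h₂ M).1 hM) (component_prop D Y)
      (F.toStable.map b ≫ _), comp_zero]
  · intro h
    obtain ⟨Z, a, b, hZ, e⟩ := exists_complement D Y
    obtain ⟨Q, hQ, c, d, hcd⟩ := (F.toStable_map_eq_iff (f := f - g) (g := (f - g) ≫ a ≫ b)).1 (by
      conv_lhs => rw [← Category.comp_id (F.toStable.map _), ← e, Preadditive.comp_add,
        ← Category.assoc, h, zero_comp, zero_add]
      rw [Functor.map_comp, Functor.map_comp])
    refine ⟨Z ⊞ Q, (relativeExactStructure_projectives D h₁ h₂ _).2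
      (right_toStable_biprod D hZ hQ), biprod.lift ((f - g) ≫ a) c, biprod.desc b d, ?_⟩
    rw [biprod.lift_desc, ← hcd]
    simp

/-- The projection of `E` onto the summand `P₁` of the stable category. -/
noncomputable def componentFunctor : E ⥤ P₁.FullSubcategory where
  obj X := ⟨F.toStable.obj (component D X), component_prop D X⟩
  map {X Y} f := ObjectProperty.homMk
    (F.toStable.map (incl D X) ≫ F.toStable.map f ≫ F.toStable.map (proj D Y))
  map_id X := P₁.hom_ext (by simp)
  map_comp {X Y Z} f g := P₁.hom_ext (by
    simpa using (comp_proj_incl_comp D (component_prop D X)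
      (F.toStable.map (incl D X) ≫ F.toStable.map f)
      (F.toStable.map g ≫ F.toStable.map (proj D Z))).symm)

/-- The functor from the stable category of the relative exact structure to `P₁`. -/
noncomputable def relativeProjection : (relative D h₁ h₂).Stable ⥤ P₁.FullSubcategory :=
  CategoryTheory.Quotient.lift _ (componentFunctor D) (fun X _ f g h => P₁.hom_ext
    (congrArg (F.toStable.map (incl D X) ≫ ·) ((relative_stableRel_iff D h₁ h₂ f g).1 h)))

theorem relativeProjection_map_hom {X Y : E} (f : X ⟶ Y) :
    ((relativeProjection D h₁ h₂).map ((relative D h₁ h₂).toStable.map f)).hom =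
      F.toStable.map (incl D X) ≫ F.toStable.map f ≫ F.toStable.map (proj D Y) := rfl

instance : (relativeProjection D h₁ h₂).Additive where
  map_add {X Y f g} := by
    obtain ⟨f, rfl⟩ := exists_toStable_map _ f
    obtain ⟨g, rfl⟩ := exists_toStable_map _ g
    refine P₁.hom_ext ?_
    change F.toStable.map _ ≫ F.toStable.map (f + g) ≫ F.toStable.map _ =
      F.toStable.map _ ≫ F.toStable.map f ≫ F.toStable.map _ +
        F.toStable.map _ ≫ F.toStable.map g ≫ F.toStable.map _
    rw [Functor.map_add, Preadditive.add_comp, Preadditive.comp_add]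
    rfl

instance {k : Type w} [Field k] [Linear k E] : (relativeProjection D h₁ h₂).Linear k where
  map_smul {X Y} f r := by
    obtain ⟨f, rfl⟩ := exists_toStable_map _ f
    refine P₁.hom_ext ?_
    change F.toStable.map _ ≫ (r • F.toStable.map f) ≫ F.toStable.map _ =
      r • (F.toStable.map _ ≫ F.toStable.map f ≫ F.toStable.map _)
    rw [Linear.smul_comp, Linear.comp_smul]

/-- A morphism `g` of components is the image of `proj ≫ g ≫ incl`, and an object of `P₁` is
isomorphic to its own component. -/
instance : (relativeProjection D h₁ h₂).IsEquivalence where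
  faithful := ⟨fun {X Y f g} h => by
    obtain ⟨f, rfl⟩ := exists_toStable_map _ f
    obtain ⟨g, rfl⟩ := exists_toStable_map _ g
    rw [toStable_map_eq_iff, relative_stableRel_iff]
    have h' := congrArg InducedCategory.Hom.hom h
    erw [relativeProjection_map_hom, relativeProjection_map_hom] at h'
    rw [← proj_incl_comp D (component_prop D _) (F.toStable.map f ≫ _), h',
      proj_incl_comp D (component_prop D _)]⟩
  full := ⟨fun {X Y} h => by
    obtain ⟨g, hg⟩ := F.exists_toStable_map (X := component D X.as) (Y := component D Y.as) h.hom
    refine ⟨(relative D h₁ h₂).toStable.map (proj D X.as ≫ g ≫ incl D Y.as), P₁.hom_ext ?_⟩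
    refine (relativeProjection_map_hom D h₁ h₂ _).trans (Eq.trans ?_ hg)
    simp only [Functor.map_comp, Category.assoc, incl_proj, incl_proj_assoc, Category.comp_id]
    rfl⟩
  essSurj := ⟨fun Y => ⟨(relative D h₁ h₂).toStable.obj Y.obj.as, ⟨P₁.isoMk
    ⟨F.toStable.map (incl D Y.obj.as), F.toStable.map (proj D Y.obj.as), incl_proj D _,
      (congrArg (F.toStable.map (proj D Y.obj.as) ≫ ·) (Category.comp_id _).symm).trans
        (proj_incl_comp D Y.property (𝟙 _))⟩⟩⟩⟩

/-! ### Compatibility with the suspensions -/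

section

variable {A B Z : E} {i : A ⟶ B} {p : B ⟶ Z} {h : i ≫ p = 0}

/-- In the long exact sequence of `Hom(T, -)` the terms at `B` and `ΣB` vanish, so `Hom(T, Z) ≅
Hom(T, ΣA)`; projecting `ΣA` to the suspended component loses nothing for `T` in `P₁`. -/
theorem bijective_comp_connecting (D : IsOrthogonalDecomposition P₁ P₂)
    (h₂ : ∀ X, P₂ X → P₂ (F.suspension.obj X))
    (hS : F.conflation (ShortComplex.mk i p h)) (hB : P₂ (F.toStable.obj B))
    {s : Z ⟶ F.cosyzygy (component D A)} (hs : F.IsConnecting i p (proj D A) s)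
    {T : F.Stable} (hT : P₁ T) :
    Function.Bijective (fun f : T ⟶ F.toStable.obj Z => f ≫ F.toSuspension s) := by
  obtain ⟨T⟩ := T
  obtain ⟨t, ht⟩ := exists_isConnecting hS (𝟙 A)
  rw [← ht.map_comp_suspension hS (by simpa using hs)]
  constructor
  · intro f g hfg
    obtain ⟨d, hd⟩ := F.exists_toStable_map (f - g)
    rw [← sub_eq_zero, ← hd]
    dsimp only at hfg
    rw [← sub_eq_zero, ← Preadditive.sub_comp, ← hd] at hfg
    have h0 : F.toStable.map d ≫ F.toSuspension t = 0 := by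
      rw [← comp_suspension_proj_incl D h₂ hT (F.toStable.map d ≫ F.toSuspension t),
        Category.assoc, reassoc_of% hfg, zero_comp]
    obtain ⟨e, rfl⟩ := (ht.map_comp_eq_zero_iff hS d).1 h0
    rw [Functor.map_comp, D.hom_left_right hT hB (F.toStable.map e), zero_comp]
  · intro v
    obtain ⟨z, hz⟩ := ht.exists_map_comp_eq h (v ≫ F.suspension.map (F.toStable.map (incl D A)))
      (D.hom_left_right hT (h₂ _ hB) _)
    refine ⟨F.toStable.map z, ?_⟩
    dsimp only
    rw [reassoc_of% hz, ← Functor.map_comp, incl_proj, F.suspension.map_id, Category.comp_id]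

end

theorem relative_hull_conflation (A : E) : F.conflation (ShortComplex.mk _ _
    ((relative D h₁ h₂).hullMap_cosyzygyMap A)) :=
  ((relative D h₁ h₂).hull_conflation A).1

theorem right_relative_hull (A : E) : P₂ (F.toStable.obj ((relative D h₁ h₂).hull A)) :=
  (relativeExactStructure_injectives D h₁ h₂ _).1 ((relative D h₁ h₂).hull_injective A)

/-- The comparison of the cosyzygy of the relative exact structure with that of the component. -/
noncomputable def shiftComparison (A : E) :
    (relative D h₁ h₂).cosyzygy A ⟶ F.cosyzygy (component D A) :=
  (exists_isConnecting (relative_hull_conflation D h₁ h₂ A) (proj D A)).choose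

theorem isConnecting_shiftComparison (A : E) :
    F.IsConnecting ((relative D h₁ h₂).hullMap A) ((relative D h₁ h₂).cosyzygyMap A) (proj D A)
      (shiftComparison D h₁ h₂ A) :=
  (exists_isConnecting (relative_hull_conflation D h₁ h₂ A) (proj D A)).choose_spec

theorem isIso_incl_comp_shiftComparison (A : E) :
    IsIso (F.toStable.map (incl D ((relative D h₁ h₂).cosyzygy A)) ≫
      F.toSuspension (shiftComparison D h₁ h₂ A)) := by
  refine isIso_of_forall_bijective (component_prop D _) (h₁ _ (component_prop D A)) _
    fun T hT => ?_
  have := (bijective_comp_connecting D h₂ (relative_hull_conflation D h₁ h₂ A)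
    (right_relative_hull D h₁ h₂ A) (isConnecting_shiftComparison D h₁ h₂ A) hT).comp
    (bijective_comp_incl D hT _)
  simpa [Function.comp_def] using this

/-- Both sides are connecting morphisms of the relative hull conflation of `X`, for `f ≫ proj Y` and
`proj X ≫ incl X ≫ f ≫ proj Y`, which agree stably. -/
theorem toStable_map_comp_shiftComparison {X Y : E} (f : X ⟶ Y)
    {t : (relative D h₁ h₂).cosyzygy X ⟶ (relative D h₁ h₂).cosyzygy Y}
    (ht : (relative D h₁ h₂).IsCosyzygyLift f t) :
    F.toStable.map t ≫ F.toSuspension (shiftComparison D h₁ h₂ Y) =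
      F.toSuspension (shiftComparison D h₁ h₂ X) ≫ F.suspension.map
        (F.toStable.map (incl D X) ≫ F.toStable.map f ≫ F.toStable.map (proj D Y)) := by
  obtain ⟨e, he, ht⟩ := ht
  have hS := relative_hull_conflation D h₁ h₂ X
  rw [← Functor.map_comp, ← Functor.map_comp]
  obtain ⟨s, hs⟩ := exists_isConnecting hS (proj D X ≫ incl D X ≫ f ≫ proj D Y)
  rw [map_comp_toSuspension, (isConnecting_shiftComparison D h₁ h₂ X).map_comp_suspension hS hs]
  refine isConnecting_unique hS ?_ ((isConnecting_shiftComparison D h₁ h₂ Y).precomp he ht) hs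
  simp only [Functor.map_comp]
  rw [proj_incl_comp D (component_prop D Y)]

/-- The projection to `P₁` commutes with the suspensions, on objects. -/
noncomputable def shiftComparisonIso (A : E) :
    F.toStable.obj (component D ((relative D h₁ h₂).cosyzygy A)) ≅
      F.suspension.obj (F.toStable.obj (component D A)) :=
  haveI := isIso_incl_comp_shiftComparison D h₁ h₂ A
  asIso (F.toStable.map (incl D ((relative D h₁ h₂).cosyzygy A)) ≫
    F.toSuspension (shiftComparison D h₁ h₂ A))

/-- The projection to `P₁` commutes with the suspensions. -/
noncomputable def relativeProjectionCommShift :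
    (relative D h₁ h₂).suspension ⋙ relativeProjection D h₁ h₂ ≅
      relativeProjection D h₁ h₂ ⋙ (F.triangulation.restrict P₁ h₁).shift :=
  NatIso.ofComponents (fun X => P₁.isoMk (shiftComparisonIso D h₁ h₂ X.as)) (by
    rintro ⟨X⟩ ⟨Y⟩ f
    obtain ⟨f, rfl⟩ := exists_toStable_map _ f
    obtain ⟨t, ht⟩ := (relative D h₁ h₂).exists_cosyzygyLift f
    have hshift : (relative D h₁ h₂).suspension.map ((relative D h₁ h₂).toStable.map f) =
      (relative D h₁ h₂).toStable.map t := suspension_map_eq ht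
    have hmap : (((relativeProjection D h₁ h₂).map ((relative D h₁ h₂).suspension.map
        ((relative D h₁ h₂).toStable.map f))).hom :
          F.toStable.obj (component D ((relative D h₁ h₂).cosyzygy X)) ⟶
            F.toStable.obj (component D ((relative D h₁ h₂).cosyzygy Y))) =
        F.toStable.map (incl D _) ≫ F.toStable.map t ≫ F.toStable.map (proj D _) :=
      congrArg (fun z => ((relativeProjection D h₁ h₂).map z).hom) hshift
    refine P₁.hom_ext ((congrArg (· ≫ (shiftComparisonIso D h₁ h₂ Y).hom) hmap).trans ?_)
    refine Eq.trans ?_ (Category.assoc _ _ _).symm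
    change (F.toStable.map (incl D _) ≫ F.toStable.map t ≫ F.toStable.map (proj D _)) ≫
      F.toStable.map (incl D _) ≫ F.toSuspension (shiftComparison D h₁ h₂ Y) =
        F.toStable.map (incl D _) ≫ F.toSuspension (shiftComparison D h₁ h₂ X) ≫ F.suspension.map
          (F.toStable.map (incl D X) ≫ F.toStable.map f ≫ F.toStable.map (proj D Y))
    rw [← toStable_map_comp_shiftComparison D h₁ h₂ f ht]
    simpa only [Category.assoc] using comp_proj_incl_comp D (component_prop D _)
      (F.toStable.map (incl D _) ≫ F.toStable.map t)
      (F.toSuspension (shiftComparison D h₁ h₂ Y)))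

end FrobeniusStructure

namespace FrobeniusStructure

open ExactStructure

variable {E : Type u} [Category.{v} E] [Preadditive E] [HasZeroObject E] [HasBinaryBiproducts E]
  {F : FrobeniusStructure E} {P₁ P₂ : ObjectProperty F.Stable}

/-! ### Compatibility with distinguished triangles -/

/-- The connecting morphism of `B ↣ C ↠ cosyzygy A` represents `Σu`, and `w` lifts to `C` through
the identity. -/
theorem toSuspension_comp_suspension_map_eq_zero {A B C : E} {u : A ⟶ B} {j : B ⟶ C}
    {w : C ⟶ F.cosyzygy A} {l : F.hull A ⟶ C} (sq : IsPushout (F.hullMap A) u l j)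
    (hl : l ≫ w = F.cosyzygyMap A) (hj : j ≫ w = 0) :
    F.toSuspension w ≫ F.suspension.map (F.toStable.map u) = 0 := by
  have hC := conflation_of_isPushout (F.hull_conflation A) sq hl hj
  obtain ⟨t, ht⟩ := exists_isConnecting hC (𝟙 B)
  have hid : F.IsConnecting (F.hullMap A) (F.cosyzygyMap A) (𝟙 A) (𝟙 (F.cosyzygy A)) :=
    ⟨𝟙 _, by simp, by simp⟩
  have ht' : F.IsConnecting (F.hullMap A) (F.cosyzygyMap A) (𝟙 A ≫ u) t := by
    simpa using ht.precomp (a := u) (b := l) (z := 𝟙 _) sq.w (by simp [hl])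
  rw [← Category.comp_id w, ← map_comp_toSuspension, Category.assoc,
    hid.map_comp_suspension (F.hull_conflation A) ht']
  exact (ht.map_comp_eq_zero_iff hC w).2 ⟨𝟙 _, Category.id_comp _⟩

section

variable (D : IsOrthogonalDecomposition P₁ P₂) (h₂ : ∀ X, P₂ X → P₂ (F.suspension.obj X))
  {A J K B C A₁ B₁ C₁ : E} {i : A ⟶ J} {p : J ⟶ K} {h : i ≫ p = 0}
  (hS : F.conflation (ShortComplex.mk i p h)) (hJ : P₂ (F.toStable.obj J))
  {s : K ⟶ F.cosyzygy (component D A)} (hs : F.IsConnecting i p (proj D A) s)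
  {u : A ⟶ B} {l : J ⟶ C} {j : B ⟶ C} (sq : IsPushout i u l j) {w : C ⟶ K}
  (hl : l ≫ w = p) (hj : j ≫ w = 0)
  {u₁ : component D A ⟶ component D B}
  (hu : F.toStable.map (proj D A) ≫ F.toStable.map u₁ =
    F.toStable.map u ≫ F.toStable.map (proj D B))
  {l₁ : F.hull (component D A) ⟶ C₁} {j₁ : component D B ⟶ C₁}
  (sq₁ : IsPushout (F.hullMap (component D A)) u₁ l₁ j₁) {w₁ : C₁ ⟶ F.cosyzygy (component D A)}
  (hl₁ : l₁ ≫ w₁ = F.cosyzygyMap (component D A)) (hj₁ : j₁ ≫ w₁ = 0)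
  {φ : C ⟶ C₁} (hφ : j ≫ φ = proj D B ≫ j₁) (hφw : φ ≫ w₁ = w ≫ s)

include hS hs sq hu hl₁ hj₁ sq₁ hl hj in
/-- There is a morphism from the pushout of a conflation whose middle term lies in `P₂` to the
cone of the induced morphism on components. -/
theorem exists_hom_component_cone : ∃ φ : C ⟶ C₁, j ≫ φ = proj D B ≫ j₁ ∧ φ ≫ w₁ = w ≫ s := by
  obtain ⟨e, he, hs⟩ := hs
  obtain ⟨y, hy⟩ := exists_extension_of_map_eq_zero (f := u ≫ proj D B - proj D A ≫ u₁)
    ⟨K, p, h, hS⟩ (by rw [Functor.map_sub, Functor.map_comp, Functor.map_comp, hu, sub_self])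
  -- The square on `u` and `u₁` commutes only stably; its defect extends to `y` on `J`, and `y ≫ j₁`
  -- corrects `e ≫ l₁` so that the pushout square is respected.
  refine ⟨sq.desc (e ≫ l₁ + y ≫ j₁) (proj D B ≫ j₁) ?_, sq.inr_desc _ _ _, sq.hom_ext ?_ ?_⟩
  · rw [Preadditive.comp_add, reassoc_of% he, reassoc_of% hy, sq₁.w]
    simp [Preadditive.sub_comp]
  · simp [hl₁, hj₁, reassoc_of% hl, hs]
  · simp [hj₁, reassoc_of% hj]

-- The five lemma, by hand, for `Hom(T, -)` applied to `B ⟶ C ⟶ K` and the triangle on components: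
-- the projection of `B` and the comparison `s` on `K` are bijective on morphisms from `T`.
include hS hJ hs sq hl hj hu sq₁ hl₁ hj₁ hφ hφw h₂ in
theorem bijective_comp_hom_component_cone {T : F.Stable} (hT : P₁ T) :
    Function.Bijective (fun f : T ⟶ F.toStable.obj C => f ≫ F.toStable.map φ) := by
  obtain ⟨T, rfl⟩ : ∃ T' : E, F.toStable.obj T' = T := ⟨T.as, rfl⟩
  have hb := bijective_comp_connecting D h₂ hS hJ hs hT
  have hC := conflation_of_isPushout hS sq hl hj
  have hH := F.hull_conflation (component D A)
  have hC₁ := conflation_of_isPushout hH sq₁ hl₁ hj₁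
  have hφw' : F.toStable.map φ ≫ F.toSuspension w₁ = F.toStable.map w ≫ F.toSuspension s := by
    rw [map_comp_toSuspension, map_comp_toSuspension, hφw]
  have hφ' : F.toStable.map j ≫ F.toStable.map φ =
      F.toStable.map (proj D B) ≫ F.toStable.map j₁ := by
    rw [← Functor.map_comp, hφ, Functor.map_comp]
  constructor
  · suffices H : ∀ f : F.toStable.obj T ⟶ F.toStable.obj C, f ≫ F.toStable.map φ = 0 → f = 0 by
      intro f g hfg
      exact sub_eq_zero.1 (H _ ((Preadditive.sub_comp _ _ _).trans (sub_eq_zero.2 hfg)))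
    intro f hf
    obtain ⟨f, rfl⟩ := F.exists_toStable_map f
    have hfw : F.toStable.map f ≫ F.toStable.map w = 0 := by
      refine hb.1 ?_
      dsimp only
      rw [Category.assoc, ← hφw', reassoc_of% hf, zero_comp, zero_comp]
    obtain ⟨g, hg⟩ := exists_map_comp_eq_of_comp_eq_zero hC f (by rw [Functor.map_comp, hfw])
    rw [Functor.map_comp] at hg
    rw [← hg, Category.assoc, hφ'] at hf
    obtain ⟨k, hk⟩ := exists_map_comp_eq_of_isPushout hH sq₁ (g ≫ proj D B)
      (by simpa using hf)
    rw [Functor.map_comp, Functor.map_comp] at hk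
    have hgk : F.toStable.map g =
        F.toStable.map k ≫ F.toStable.map (incl D A) ≫ F.toStable.map u := by
      rw [← comp_proj_incl D hT (F.toStable.map g), ← reassoc_of% hk,
        ← comp_proj_incl D hT (F.toStable.map k ≫ F.toStable.map (incl D A) ≫ F.toStable.map u)]
      simp only [Category.assoc]
      rw [← reassoc_of% hu, incl_proj_assoc]
    -- Now `f` passes through `u ≫ j = i ≫ l`, hence through `J`, which receives no nonzero morphism
    -- from `T`.
    rw [← hg, hgk, Category.assoc, Category.assoc, ← Functor.map_comp, ← sq.w, Functor.map_comp,
      ← Category.assoc, ← Category.assoc,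
      D.hom_left_right hT hJ ((F.toStable.map k ≫ _) ≫ F.toStable.map i), zero_comp]
  · intro d
    obtain ⟨v, hv⟩ := hb.2 (d ≫ F.toSuspension w₁)
    dsimp only at hv
    obtain ⟨v, rfl⟩ := F.exists_toStable_map v
    obtain ⟨t, ht⟩ := exists_isConnecting hC (𝟙 B)
    have htu : F.IsConnecting i p u t := by
      simpa using ht.precomp (a := u) (b := l) (z := 𝟙 _) sq.w (by simp [hl])
    have hts : F.toSuspension t ≫ F.suspension.map (F.toStable.map (proj D B)) =
        F.toSuspension s ≫ F.suspension.map (F.toStable.map u₁) := by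
      obtain ⟨r, hr⟩ := exists_isConnecting hS (u ≫ proj D B)
      obtain ⟨r', hr'⟩ := exists_isConnecting hS (proj D A ≫ u₁)
      rw [htu.map_comp_suspension hS hr, hs.map_comp_suspension hS hr']
      exact isConnecting_unique hS (by rw [Functor.map_comp, Functor.map_comp, hu]) hr hr'
    -- The obstruction to lifting `v` to `C` is detected on the component of `B`, where it becomes
    -- `d ≫ w₁ ≫ Σu₁ = 0`. The lift `z` then has to be corrected by a morphism from `B`.
    obtain ⟨z, rfl⟩ := (ht.map_comp_eq_zero_iff hC v).1 (by
      rw [← comp_suspension_proj_incl D h₂ hT (F.toStable.map v ≫ F.toSuspension t),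
        Category.assoc, reassoc_of% hts, reassoc_of% hv,
        reassoc_of% (toSuspension_comp_suspension_map_eq_zero sq₁ hl₁ hj₁), zero_comp, comp_zero])
    obtain ⟨d', hd'⟩ := F.exists_toStable_map (d - F.toStable.map z ≫ F.toStable.map φ)
    obtain ⟨g, hg⟩ := exists_map_comp_eq_of_comp_eq_zero hC₁ d' (by
      rw [← toSuspension_eq_zero_iff, ← map_comp_toSuspension, hd', Preadditive.sub_comp, ← hv,
        Functor.map_comp, Category.assoc, Category.assoc, hφw', sub_self])
    refine ⟨F.toStable.map z + F.toStable.map g ≫ F.toStable.map (incl D B) ≫ F.toStable.map j, ?_⟩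
    dsimp only
    rw [Preadditive.add_comp, Category.assoc, Category.assoc, hφ', incl_proj_assoc,
      ← Functor.map_comp F.toStable g, hg, hd']
    abel

-- The cone of the induced morphism on components lies in `P₁` by `hcone`, so Yoneda in `P₁`
-- identifies it with the component of `C`.
include hS hJ hs sq hl hj h₂ in
theorem isDistinguished_component
    (hcone : ∀ ⦃X Y Z : F.Stable⦄ (f : X ⟶ Y) (g : Y ⟶ Z) (h : Z ⟶ F.suspension.obj X),
      F.IsDistinguished f g h → P₁ X → P₁ Y → P₁ Z) :
    F.IsDistinguished
      (F.toStable.map (incl D A) ≫ F.toStable.map u ≫ F.toStable.map (proj D B))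
      (F.toStable.map (incl D B) ≫ F.toStable.map j ≫ F.toStable.map (proj D C))
      (F.toStable.map (incl D C) ≫ F.toStable.map w ≫ F.toSuspension s) := by
  obtain ⟨u₁, hu₁⟩ := F.exists_toStable_map
    (F.toStable.map (incl D A) ≫ F.toStable.map u ≫ F.toStable.map (proj D B))
  have hu : F.toStable.map (proj D A) ≫ F.toStable.map u₁ =
      F.toStable.map u ≫ F.toStable.map (proj D B) := by
    rw [hu₁, proj_incl_comp D (component_prop D B)]
  obtain ⟨C₁, l₁, j₁, sq₁, -⟩ := F.inflation_pushout (F.hullMap (component D A)) u₁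
    (F.hullMap_inflation _)
  obtain ⟨w₁, hl₁, hj₁⟩ : ∃ w₁ : C₁ ⟶ F.cosyzygy (component D A),
      l₁ ≫ w₁ = F.cosyzygyMap _ ∧ j₁ ≫ w₁ = 0 :=
    ⟨sq₁.desc (F.cosyzygyMap _) 0 (by simp [F.hullMap_cosyzygyMap]), by simp, by simp⟩
  have hT : F.IsStandardTriangle u₁ j₁ w₁ := ⟨l₁, sq₁, hl₁, hj₁⟩
  have hT' : F.IsDistinguished (F.toStable.map u₁) (F.toStable.map j₁) (F.toSuspension w₁) :=
    ⟨_, _, _, u₁, j₁, w₁, Iso.refl _, Iso.refl _, Iso.refl _, hT, by simp, by simp, by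
      rw [Iso.refl_hom, F.suspension.map_id, Iso.refl_hom, Category.comp_id, Category.id_comp]
      rfl⟩
  have hC₁ : P₁ (F.toStable.obj C₁) := hcone _ _ _ hT' (component_prop D A) (component_prop D B)
  obtain ⟨φ, hφ, hφw⟩ := exists_hom_component_cone D hS hs sq hl hj hu sq₁ hl₁ hj₁
  have : IsIso (F.toStable.map (incl D C) ≫ F.toStable.map φ) := by
    refine isIso_of_forall_bijective (component_prop D C) hC₁ _ fun T hT => ?_
    have := (bijective_comp_hom_component_cone D h₂ hS hJ hs sq hl hj hu sq₁ hl₁ hj₁ hφ hφw hT).comp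
      (bijective_comp_incl D hT C)
    simpa [Function.comp_def] using this
  refine IsDistinguished.of_iso F (Iso.refl _) (Iso.refl _)
    (asIso (F.toStable.map (incl D C) ≫ F.toStable.map φ)) hT' ?_ ?_ ?_
  · simp [hu₁]
  · have := comp_proj_incl_comp D (component_prop D B)
      (F.toStable.map (incl D B) ≫ F.toStable.map j) (F.toStable.map φ)
    simp only [Category.assoc] at this
    simp only [asIso_hom, Iso.refl_hom, Category.id_comp, Category.assoc, this]
    rw [← Functor.map_comp, hφ, Functor.map_comp, incl_proj_assoc]
  · rw [Iso.refl_hom, F.suspension.map_id, Category.comp_id, asIso_hom, Category.assoc,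
      F.map_comp_toSuspension w s, F.map_comp_toSuspension φ w₁, hφw]

end

variable (D : IsOrthogonalDecomposition P₁ P₂)
  (h₁ : ∀ X, P₁ X → P₁ (F.suspension.obj X)) (h₂ : ∀ X, P₂ X → P₂ (F.suspension.obj X))

/-- The stable category of the relative exact structure is triangle equivalent to the summand
`P₁`. -/
noncomputable def relativeTriangleEquivalence (k : Type w) [Field k] [Linear k E]
    (hcone : ∀ ⦃X Y Z : F.Stable⦄ (f : X ⟶ Y) (g : Y ⟶ Z) (h : Z ⟶ F.suspension.obj X),
      F.IsDistinguished f g h → P₁ X → P₁ Y → P₁ Z) :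
    Triangulation.TriangleEquivalence k (relative D h₁ h₂).triangulation
      (F.triangulation.restrict P₁ h₁) where
  functor := relativeProjection D h₁ h₂
  isEquivalence := inferInstance
  additive := inferInstance
  linear := inferInstance
  commShift := relativeProjectionCommShift D h₁ h₂
  map_dist {X Y Z} f g h := by
    rintro ⟨A, B, C, u, j, w, α, β, γ, ⟨l, sq, hl, hj⟩, hf, hg, hh⟩
    have H := isDistinguished_component D h₂ (relative_hull_conflation D h₁ h₂ A)
      (right_relative_hull D h₁ h₂ A) (isConnecting_shiftComparison D h₁ h₂ A) sq hl hj hcone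
    let Φ := relativeProjection D h₁ h₂ ⋙ P₁.ι
    refine IsDistinguished.of_iso F (Φ.mapIso α) (Φ.mapIso β) (Φ.mapIso γ) H ?_ ?_ ?_
    · exact (Φ.map_comp _ _).symm.trans ((congrArg Φ.map hf).trans (Φ.map_comp _ _))
    · exact (Φ.map_comp _ _).symm.trans ((congrArg Φ.map hg).trans (Φ.map_comp _ _))
    · let R := relativeProjection D h₁ h₂
      let σ := relativeProjectionCommShift D h₁ h₂
      have hR : (R.map h ≫ σ.hom.app X) ≫ (F.triangulation.restrict P₁ h₁).shift.map (R.map α.hom) =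
          R.map γ.hom ≫ R.map ((relative D h₁ h₂).toSuspension w) ≫ σ.hom.app _ := by
        have hn := σ.hom.naturality α.hom
        have hw : R.map h ≫ R.map ((relative D h₁ h₂).suspension.map α.hom) =
            R.map γ.hom ≫ R.map ((relative D h₁ h₂).toSuspension w) :=
          (R.map_comp _ _).symm.trans ((congrArg R.map hh).trans (R.map_comp _ _))
        exact (Category.assoc _ _ _).trans ((congrArg (R.map h ≫ ·) hn.symm).trans
          ((Category.assoc _ _ _).symm.trans ((congrArg (· ≫ σ.hom.app _) hw).trans
            (Category.assoc _ _ _))))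
      refine (congrArg InducedCategory.Hom.hom hR).trans (congrArg ((R.map γ.hom).hom ≫ ·) ?_)
      -- The projected `w` followed by the shift comparison contains an extra `proj ≫ incl`, which
      -- is harmless because the source is a component.
      refine Eq.trans ?_ (comp_proj_incl_comp D (component_prop D C)
        (F.toStable.map (incl D C) ≫ F.toStable.map w)
        (F.toSuspension (shiftComparison D h₁ h₂ A)) |>.trans (Category.assoc _ _ _))
      change (F.toStable.map (incl D C) ≫ F.toStable.map w ≫ F.toStable.map (proj D _)) ≫
        F.toStable.map (incl D _) ≫ F.toSuspension (shiftComparison D h₁ h₂ A) = _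
      simp only [Category.assoc]

end FrobeniusStructure

end ExactCat

theorem lemma2p7 {k : Type w} [Field k] [IsAlgClosed k]
    {E : Type u} [Category.{v} E] [Preadditive E] [Linear k E]
    [HasZeroObject E] [HasBinaryBiproducts E]
    (F : ExactCat.FrobeniusStructure E) (C₁ C₂ : ObjectProperty F.Stable)
    (hC : F.triangulation.IsDirectSum C₁ C₂)
    (S : F.Stable ⥤ F.Stable) (hS : ExactCat.IsSerreFunctor k S) :
    (∃ h₁ : ∀ X, C₁ X → C₁ (S.obj X),
      ExactCat.IsSerreFunctor k (C₁.lift (C₁.ι ⋙ S) (fun X => h₁ _ X.property))) ∧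
    (∃ h₂ : ∀ X, C₂ X → C₂ (S.obj X),
      ExactCat.IsSerreFunctor k (C₂.lift (C₂.ι ⋙ S) (fun X => h₂ _ X.property))) ∧
    ∃ G : ExactCat.FrobeniusStructure E,
      Nonempty (ExactCat.Triangulation.TriangleEquivalence k G.triangulation
        (F.triangulation.restrict C₁ (fun X hX => (hC.left.shift_iff X).2 hX))) := by
  have D := hC.isOrthogonalDecomposition
  refine ⟨⟨D.serre_obj hS, D.isSerreFunctor_restrict hS _⟩,
    ⟨D.symm.serre_obj hS, D.symm.isSerreFunctor_restrict hS _⟩,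
    ExactCat.FrobeniusStructure.relative D (fun X hX => (hC.left.shift_iff X).2 hX)
      (fun X hX => (hC.right.shift_iff X).2 hX), ⟨?_⟩⟩
  exact ExactCat.FrobeniusStructure.relativeTriangleEquivalence D _ _ k hC.left.cone
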